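/- Let $A$ be a finite set with the discrete $\sigma$-algebra, let $I=\mathbb N$ or $I=\mathbb Z$, and let $\Omega=A^I$ with its product (Borel) $\sigma$-algebra $\mathcal F$ and coordinates $\zeta_i(\omega)=\omega_i$. Let $\mu$ be a stationary probability measure on $\Omega$, i.e. one invariant under the left shift $(T\omega)_i=\omega_{i+1}$, and let $\overrightarrow{\mathcal T}=\bigcap_{m\ge 0}\sigma(\zeta_m,\zeta_{m+1},\dots)$ be the future tail $\sigma$-algebra. **Induced decomposition.** A decomposition of $\mu$ consists of a standard Borel probability space $(\Theta,\mathcal B,\lambda)$ and probability measures $\mu_\theta$ on $\Omega$ ($\theta\in\Theta$), with $\theta\mapsto\mu_\theta(S)$ $\mathcal B$-measurable and $\mu(S)=\int_\Theta\mu_\theta(S)\,\lambda(d\theta)$ for every $S\in\mathcal F$. It is *induced by* a $\sigma$-algebra $\mathcal D\subseteq\mathcal F$ if there is a measurable map $\alpha:\Omega\to\Theta$ such that $\alpha_*\mu=\lambda$; $\alpha$ generates $\mathcal D$ modulo $\mu$-null sets (every $\alpha^{-1}(B)$, $B\in\mathcal B$, agrees up to a $\mu$-null set with a member of $\mathcal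 D$, and every member of $\mathcal D$ agrees up to a $\mu$-null set with some $\alpha^{-1}(B)$, $B\in\mathcal B$); and $\mu_\theta(\{\omega:\alpha(\omega)=\theta\})=1$ for $\lambda$-almost every $\theta$. **Weak learnability.** For a probability measure $\nu$ on $\Omega$ and outcomes $a_0,\dots,a_{n-1}$ with $\nu(\zeta_0=a_0,\dots,\zeta_{n-1}=a_{n-1})>0$, let $\nu(\cdot\mid a_0,\dots,a_{n-1})$ be the conditional distribution of $\zeta_n$ given $\zeta_0=a_0,\dots,\zeta_{n-1}=a_{n-1}$, and for distributions $p,q$ on $A$ let $\|p-q\|=\max_{a\in A}|p[a]-q[a]|$. A probability measure $\tilde\mu$ weakly merges to $\nu$ if for $\nu$-almost every $\omega$, with $a_k=\omega_k$ for $k\ge0$, every history $(a_0,\dots,a_{n-1})$ has positive $\tilde\mu$-probability and $$\lim_{N\to\infty}\frac1N\sum_{n=0}^{N-1}\bigl\|\tilde\mu(\cdot\mid a_0,\dots,a_{n-1})-\nu(\cdot\mid a_0,\dots,a_{n-1})\bigr\|=0 .$$ A decomposition of $\mu$ is *weakly learnable* if $\mu$ weakly merges to $\mu_\theta$ for $\lambda$-almost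 every $\theta$. **Theorem.** A decomposition of $\mu$ induced by the future tail $\overrightarrow{\mathcal T}$ exists, and every such decomposition is weakly learnable. -/

import Mathlib

open MeasureTheory ProbabilityTheory Filter Topology

namespace WeakLearning

/-! Realizations of a process with outcomes in `A` are functions `ω : I → A`, where the time set `I`
is `ℕ` (one-sided processes) or `ℤ` (two-sided processes); `ω n` is the outcome of period `n`.
The belief of an agent is a probability measure on `I → A` (product σ-algebra). The agent observes
the process from period `0` onwards. -/

section Processes

variable {I A : Type*} [AddMonoidWithOne I]

/-- The left shift `(T ω) i = ω (i + 1)`. -/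
def shift (ω : I → A) : I → A := fun i => ω (i + 1)

/-- The event that the outcomes of the periods `0, …, n - 1` are those of `ω`. -/
def history (n : ℕ) (ω : I → A) : Set (I → A) :=
  {x | ∀ k : ℕ, k < n → x (k : I) = ω (k : I)}

variable [MeasurableSpace A]

/-- A law `μ` is stationary if it is invariant under the shift. -/
def IsStationary (μ : Measure (I → A)) : Prop :=
  MeasurePreserving shift μ μ

/-- The future tail: the intersection over `m ≥ 0` of the σ-algebras generated by the
outcomes of the periods `m, m + 1, …`. -/
abbrev futureTail (I A : Type*) [AddMonoidWithOne I] [MeasurableSpace A] :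
    MeasurableSpace (I → A) :=
  ⨅ m : ℕ, ⨆ n : ℕ, ⨆ _ : m ≤ n,
    MeasurableSpace.comap (fun ω : I → A => ω (n : I)) inferInstance

/-- The `n`-period predictive distribution `μ(· | a₀, …, aₙ₋₁)` along the realization
`ω = (a₀, a₁, …)`: the conditional probability that the outcome of period `n` is `a`. It is only
meaningful when the history has positive probability. -/
noncomputable def predictive (μ : Measure (I → A)) (n : ℕ) (ω : I → A) : A → ℝ :=
  fun a => (μ[|history n ω]).real {x | x (n : I) = a}

/-- Strong Cesàro convergence of a real sequence `x` to `l`. -/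
def StronglyCesaroTendsto (x : ℕ → ℝ) (l : ℝ) : Prop :=
  Tendsto (fun N : ℕ => (1 / (N : ℝ)) * ∑ n ∈ Finset.range N, |x n - l|) atTop (𝓝 0)

/-- `μ'` weakly merges to `ν`: for `ν`-almost every realization, all finite histories have positive
`μ'`-probability (so that the predictions of `μ'` are defined; those of `ν` are defined almost
surely), and the distance between the predictions of `μ'` and of `ν` strongly Cesàro converges to
`0`. The norm on `A → ℝ` is the maximum norm. -/
def WeaklyMerges [Fintype A] (μ' ν : Measure (I → A)) : Prop :=
  ∀ᵐ ω ∂ν, (∀ n : ℕ, μ' (history n ω) ≠ 0) ∧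
    StronglyCesaroTendsto (fun n => ‖predictive μ' n ω - predictive ν n ω‖) 0

end Processes

section Decomposition

variable {Ω Θ : Type*}

/-- `(Θ, lam, (κ θ))` is a decomposition of `μ`: `lam` is a probability measure on the standard
Borel space `Θ`, the `κ θ` are probability measures depending measurably on `θ` (this is what a
Markov kernel is), and `μ = ∫ κ θ dlam(θ)`. -/
structure IsDecomposition [MeasurableSpace Ω] [MeasurableSpace Θ] [StandardBorelSpace Θ] (μ : Measure Ω) (lam : Measure Θ)
    (κ : Kernel Θ Ω) : Prop where
  isProbabilityMeasure : IsProbabilityMeasure lam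
  isMarkovKernel : IsMarkovKernel κ
  apply_eq : ∀ S : Set Ω, MeasurableSet S → μ S = ∫⁻ θ, κ θ S ∂lam

/-- `α : Ω → Θ` exhibits `(Θ, lam)` as the quotient of `(Ω, μ)` by the σ-algebra `D`: it is
measurable, carries `μ` to `lam`, and generates `D` up to `μ`-null sets. Here `μ` and `α` refer to
the ambient σ-algebra of `Ω`, which is declared after `D`; `D` only enters where it is written. -/
structure IsMeasurableQuotient (D : MeasurableSpace Ω) [MeasurableSpace Ω] [MeasurableSpace Θ]
    (μ : Measure Ω) (lam : Measure Θ) (α : Ω → Θ) : Prop where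
  measurePreserving : MeasurePreserving α μ lam
  preimage_mem : ∀ B : Set Θ, MeasurableSet B →
    ∃ S : Set Ω, MeasurableSet[D] S ∧ α ⁻¹' B =ᵐ[μ] S
  exists_preimage : ∀ S : Set Ω, MeasurableSet[D] S →
    ∃ B : Set Θ, MeasurableSet B ∧ S =ᵐ[μ] α ⁻¹' B

/-- `(Θ, lam, (κ θ))` is the decomposition of `μ` induced by `D`: it is a decomposition of `μ`,
`(Θ, lam)` is the quotient of `μ` by `D`, and almost every `κ θ` is concentrated on the fibre of
the quotient map over `θ`. -/
def IsInducedDecomposition (D : MeasurableSpace Ω) [MeasurableSpace Ω] [MeasurableSpace Θ]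
    [StandardBorelSpace Θ] (μ : Measure Ω) (lam : Measure Θ) (κ : Kernel Θ Ω) : Prop :=
  IsDecomposition μ lam κ ∧
    ∃ α : Ω → Θ, IsMeasurableQuotient D μ lam α ∧ ∀ᵐ θ ∂lam, κ θ (α ⁻¹' {θ}) = 1

/-- The decomposition `(Θ, lam, (κ θ))` of `μ` is weakly learnable: `μ` weakly merges with `κ θ`
for `lam`-almost every `θ`. -/
def IsWeaklyLearnable {I A : Type*} [AddMonoidWithOne I] [MeasurableSpace A] [Fintype A]
    [MeasurableSpace Θ] (μ : Measure (I → A)) (lam : Measure Θ) (κ : Kernel Θ (I → A)) : Prop :=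
  ∀ᵐ θ ∂lam, WeaklyMerges μ (κ θ)

end Decomposition

end WeakLearning

/-! Existence is disintegration. Conditional probabilities given the tail, read off on a countable
π-system, form a quotient map `α`, and the conditional law of `ω` given `α ω` lives on a fibre.

Conversely, the components of any induced decomposition are the conditional laws given the tail `𝒯`
(`IsDecomposition.ae_eq_condExp`). So learnability compares the prediction of the next outcome from
the past with that from the past and `𝒯`.

The gap is first controlled in mean by entropy. The entropy of the first `n` outcomes, with or
without `𝒯`, can be expanded forwards or backwards in time. Backwards, knowing `𝒯` is worth no more
than replacing a finite future by the whole future, which contains `𝒯`; by stationarity and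
martingale convergence this gain tends to zero as the finite future lengthens. Forwards, the same
total is the sum of the predictive gains, so arbitrarily small gains recur
(`sum_condEntropy_sub_le`). Strong convexity of `x log x` turns small gains into small `L²`
distances.

The passage to almost sure Cesàro convergence is a Maker-type argument
(`measureReal_exists_lt_sum_le`). Up to a shift, the gap at period `n` is a gap for a fixed target
`L` with window `n`, evaluated along the orbit. Doob's maximal inequality dominates these gaps by
one function of small integral, uniformly in the window, and the maximal ergodic inequality controls
its averages. -/

namespace WeakLearning

/-! ### Quotient maps and disintegration. -/

section Existence

/-- Finite intersections of the members of a countable generating sequence. -/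
def natPiSystem (Ω : Type*) [MeasurableSpace Ω] [MeasurableSpace.CountablyGenerated Ω]
    (F : Finset ℕ) : Set Ω :=
  ⋂ i ∈ F, MeasurableSpace.natGeneratingSequence Ω i

variable {Ω : Type*}

theorem measurableSet_natPiSystem [MeasurableSpace Ω] [MeasurableSpace.CountablyGenerated Ω]
    (F : Finset ℕ) : MeasurableSet (natPiSystem Ω F) :=
  F.measurableSet_biInter fun i _ => MeasurableSpace.measurableSet_natGeneratingSequence i

theorem isPiSystem_natPiSystem [MeasurableSpace Ω] [MeasurableSpace.CountablyGenerated Ω] :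
    IsPiSystem (Set.range (natPiSystem Ω)) := by
  rintro _ ⟨F, rfl⟩ _ ⟨G, rfl⟩ _
  refine ⟨F ∪ G, ?_⟩
  ext ω
  simp only [natPiSystem, Set.mem_iInter, Set.mem_inter_iff, Finset.mem_union]
  grind

theorem generateFrom_natPiSystem [m : MeasurableSpace Ω]
    [MeasurableSpace.CountablyGenerated Ω] :
    m = MeasurableSpace.generateFrom (Set.range (natPiSystem Ω)) := by
  apply le_antisymm
  · conv_lhs => rw [← MeasurableSpace.generateFrom_natGeneratingSequence Ω]
    refine MeasurableSpace.generateFrom_mono ?_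
    rintro _ ⟨n, rfl⟩
    exact ⟨{n}, by simp [natPiSystem]⟩
  · refine MeasurableSpace.generateFrom_le ?_
    rintro _ ⟨F, rfl⟩
    exact measurableSet_natPiSystem F

/-- A sub-σ-algebra of a standard Borel probability space has a quotient map. -/
theorem exists_isMeasurableQuotient {D mΩ : MeasurableSpace Ω} [StandardBorelSpace Ω]
    (μ : Measure Ω) [IsProbabilityMeasure μ] (hD : D ≤ mΩ) :
    ∃ α : Ω → Finset ℕ → ℝ, Measurable α ∧ IsMeasurableQuotient D μ (μ.map α) α := by
  -- A countable π-system determines a probability measure, so these countably many coordinates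
  -- encode the whole conditional law.
  let α : Ω → Finset ℕ → ℝ := fun ω F => (condExpKernel μ D ω).real (natPiSystem Ω F)
  have hαD : Measurable[D] α := by
    refine @measurable_pi_lambda _ _ _ D _ _ fun F => ?_
    exact (measurable_condExpKernel (measurableSet_natPiSystem F)).ennreal_toReal
  have hα : Measurable α := hαD.mono hD le_rfl
  refine ⟨α, hα, ⟨hα, rfl⟩, fun B hB => ⟨α ⁻¹' B, hαD hB, ae_eq_refl _⟩, fun S hS => ?_⟩
  have hprob : ∀ ω, IsProbabilityMeasure (condExpKernel μ D ω) := fun ω =>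
    IsMarkovKernel.isProbabilityMeasure (κ := condExpKernel μ D) ω
  have hk : Measurable[MeasurableSpace.comap α inferInstance]
      (fun ω => (condExpKernel μ D ω : Measure Ω)) := by
    refine @Measurable.measure_of_isPiSystem_of_isProbabilityMeasure Ω Ω
      (MeasurableSpace.comap α inferInstance) mΩ _ hprob _ generateFrom_natPiSystem
      isPiSystem_natPiSystem ?_
    rintro _ ⟨F, rfl⟩
    have h1 : Measurable[MeasurableSpace.comap α inferInstance] fun ω => α ω F :=
      (measurable_pi_apply F).comp (comap_measurable α)
    have h2 := h1.ennreal_ofReal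
    convert h2 using 2 with ω
    exact (ofReal_measureReal (measure_ne_top _ _)).symm
  have hkS : Measurable[MeasurableSpace.comap α inferInstance]
      (fun ω => condExpKernel μ D ω S) :=
    (Measure.measurable_coe (hD S hS)).comp hk
  -- As `S` belongs to `D`, its conditional probability is its own indicator, so `S` is almost
  -- surely the event that this probability is `1`.
  obtain ⟨B, hB, hBS⟩ := hkS (measurableSet_singleton 1)
  refine ⟨B, hB, ?_⟩
  rw [hBS]
  have h3 := condExpKernel_ae_eq_condExp (μ := μ) hD (hD S hS)
  rw [condExp_of_stronglyMeasurable hD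
    (stronglyMeasurable_const.indicator hS) ((integrable_const _).indicator (hD S hS))] at h3
  filter_upwards [h3] with ω hω
  refine propext ?_
  change ω ∈ S ↔ condExpKernel μ D ω S = 1
  by_cases h : ω ∈ S
  · simp only [h, true_iff]
    simp only [Set.indicator_of_mem h, measureReal_def] at hω
    rwa [ENNReal.toReal_eq_one_iff] at hω
  · simp only [h, false_iff]
    simp only [Set.indicator_of_notMem h, measureReal_def] at hω
    intro h1
    simp [h1] at hω

/-- The kernel is the conditional law of the identity given `α`. The joint law of `(α ω, ω)` sits on
the graph of `α`, which forces concentration on fibres. -/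
theorem exists_isInducedDecomposition {D mΩ : MeasurableSpace Ω} [StandardBorelSpace Ω]
    (μ : Measure Ω) [IsProbabilityMeasure μ] (hD : D ≤ mΩ) :
    ∃ (Θ : Type) (_ : MeasurableSpace Θ) (_ : StandardBorelSpace Θ)
        (lam : Measure Θ) (κ : Kernel Θ Ω), IsInducedDecomposition D μ lam κ := by
  obtain ⟨α, hα, hq⟩ := exists_isMeasurableQuotient μ hD
  have : Nonempty Ω := μ.nonempty_of_neZero
  have : IsProbabilityMeasure (μ.map α) := Measure.isProbabilityMeasure_map hα.aemeasurable
  have hprod : (μ.map α) ⊗ₘ condDistrib id α μ = μ.map fun ω => (α ω, ω) :=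
    compProd_map_condDistrib aemeasurable_id
  refine ⟨Finset ℕ → ℝ, inferInstance, inferInstance, μ.map α, condDistrib id α μ,
    ⟨inferInstance, inferInstance, fun S hS => ?_⟩, α, hq, ?_⟩
  · have := congrArg (fun ν : Measure _ => ν (Set.univ ×ˢ S)) hprod
    rw [Measure.compProd_apply_prod MeasurableSet.univ hS, Measure.map_apply (by fun_prop)
      (MeasurableSet.univ.prod hS)] at this
    simpa [Set.mk_preimage_prod] using this.symm
  · have hset : MeasurableSet {p : (Finset ℕ → ℝ) × Ω | α p.2 = p.1} :=
      measurableSet_eq_fun (by fun_prop) (by fun_prop)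
    have h1 : ∀ᵐ p ∂((μ.map α) ⊗ₘ condDistrib id α μ), α p.2 = p.1 := by
      rw [hprod, ae_map_iff (by fun_prop) hset]
      exact ae_of_all _ fun _ => rfl
    filter_upwards [Measure.ae_ae_of_ae_compProd h1] with θ hθ
    exact (prob_compl_eq_zero_iff (hα (measurableSet_singleton θ))).1 hθ

end Existence

/-! ### Conditional probabilities: localisation, shifts, Pythagoras. -/

section CondExp

variable {Ω : Type*} {m m' mΩ : MeasurableSpace Ω} {μ : Measure Ω}

theorem integrable_indicator_one [IsFiniteMeasure μ] {B : Set Ω} (hB : MeasurableSet B) :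
    Integrable (B.indicator fun _ => (1 : ℝ)) μ :=
  (integrable_const _).indicator hB

theorem condExp_indicator_nonneg (m : MeasurableSpace Ω) (B : Set Ω) :
    ∀ᵐ ω ∂μ, 0 ≤ (μ⟦B | m⟧) ω :=
  condExp_nonneg (ae_of_all _ fun _ => Set.indicator_nonneg (fun _ _ => zero_le_one) _)

theorem condExp_indicator_mono [IsFiniteMeasure μ] (m : MeasurableSpace Ω) {B C : Set Ω}
    (hB : MeasurableSet[mΩ] B) (hC : MeasurableSet[mΩ] C) (h : B ⊆ C) :
    ∀ᵐ ω ∂μ, (μ⟦B | m⟧) ω ≤ (μ⟦C | m⟧) ω :=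
  condExp_mono (integrable_indicator_one hB) (integrable_indicator_one hC)
    (ae_of_all _ fun _ => Set.indicator_le_indicator_of_subset h (fun _ => zero_le_one) _)

theorem condExp_indicator_mem_Icc [IsProbabilityMeasure μ] (hm : m ≤ mΩ) {B : Set Ω}
    (hB : MeasurableSet B) : ∀ᵐ ω ∂μ, (μ⟦B | m⟧) ω ∈ Set.Icc (0 : ℝ) 1 := by
  filter_upwards [condExp_indicator_nonneg (μ := μ) m B,
    condExp_indicator_mono (μ := μ) m hB MeasurableSet.univ (Set.subset_univ _)] with ω h0 h1
  refine ⟨h0, ?_⟩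
  simpa [Set.indicator_univ, condExp_const hm] using h1

/-- If `m'` and `m` have the same trace on the event `E`, then conditional probabilities given
`m'` are, on `E`, ratios of conditional probabilities given `m`. -/
theorem condExp_eq_div_of_comap_le [IsProbabilityMeasure μ] (hm : m ≤ m') (hm' : m' ≤ mΩ)
    {E B : Set Ω} (hE : MeasurableSet[m'] E) (hB : MeasurableSet B)
    (htr : m'.comap (Subtype.val : E → Ω) ≤ m.comap Subtype.val) :
    ∀ᵐ ω ∂μ, ω ∈ E → (μ⟦B | m'⟧) ω = (μ⟦B ∩ E | m⟧) ω / (μ⟦E | m⟧) ω := by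
  have hmΩ := hm.trans hm'
  have hE' := hm' _ hE
  set num := μ⟦B ∩ E | m⟧ with hnum
  set den := μ⟦E | m⟧ with hden
  have h01 : ∀ᵐ ω ∂μ, 0 ≤ num ω ∧ num ω ≤ den ω := by
    filter_upwards [condExp_indicator_nonneg (μ := μ) m (B ∩ E),
      condExp_indicator_mono (μ := μ) m (hB.inter hE') hE' Set.inter_subset_right]
      with ω h0 h1 using ⟨h0, h1⟩
  have hw : StronglyMeasurable[m] (fun ω => num ω / den ω) :=
    (stronglyMeasurable_condExp.measurable.div
      stronglyMeasurable_condExp.measurable).stronglyMeasurable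
  have hwb : ∀ᵐ ω ∂μ, ‖num ω / den ω‖ ≤ 1 := by
    filter_upwards [h01] with ω h
    rw [Real.norm_of_nonneg (div_nonneg h.1 (h.1.trans h.2))]
    exact div_le_one_of_le₀ h.2 (h.1.trans h.2)
  have hwi : Integrable (fun ω => num ω / den ω) μ :=
    Integrable.of_bound (hw.mono hmΩ).aestronglyMeasurable 1 hwb
  have hpull : μ[(fun ω => num ω / den ω) * E.indicator (fun _ => (1 : ℝ)) | m] =ᵐ[μ] num := by
    refine (condExp_stronglyMeasurable_mul_of_bound hmΩ hw (integrable_indicator_one hE') 1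
      hwb).trans ?_
    filter_upwards [h01] with ω h
    change num ω / den ω * den ω = num ω
    -- Since `0 ≤ num ≤ den`, both vanish together and the convention `0 / 0 = 0` is harmless.
    by_cases hd : den ω = 0
    · rw [hd] at h ⊢
      rw [le_antisymm h.2 h.1]; simp
    · exact div_mul_cancel₀ _ hd
  have hprod : (fun ω => num ω / den ω) * E.indicator (fun _ => (1 : ℝ)) =
      E.indicator fun ω => num ω / den ω := by
    ext ω; by_cases h : ω ∈ E <;> simp [h]
  rw [hprod] at hpull
  have hkey : E.indicator (fun ω => num ω / den ω) =ᵐ[μ]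
      μ[(B ∩ E).indicator fun _ => (1 : ℝ) | m'] := by
    refine ae_eq_condExp_of_forall_setIntegral_eq hm' (integrable_indicator_one (hB.inter hE'))
      (fun s _ _ => (hwi.indicator hE').integrableOn) (fun s hs _ => ?_)
      ((hw.mono hm).indicator hE).aestronglyMeasurable
    -- On `E`, the `m'`-event `s` coincides with an `m`-event `g`; for integrands supported on `E`,
    -- conditioning on `m` is then enough.
    obtain ⟨g, hg, hgs⟩ := htr _ ⟨s, hs, rfl⟩
    have hsg : s ∩ E = g ∩ E := by
      rw [Set.inter_comm s, Set.inter_comm g]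
      exact (Subtype.preimage_val_eq_preimage_val_iff _ _ _).1 hgs.symm
    have e1 : ∀ f : Ω → ℝ, ∫ ω in s, E.indicator f ω ∂μ = ∫ ω in g, E.indicator f ω ∂μ := by
      intro f
      rw [setIntegral_indicator hE', setIntegral_indicator hE', hsg]
    have e2 : (B ∩ E).indicator (fun _ => (1 : ℝ)) = E.indicator (B.indicator fun _ => 1) := by
      rw [Set.indicator_indicator, Set.inter_comm]
    rw [e1, e2, e1, ← e2, ← setIntegral_condExp hmΩ (hwi.indicator hE') hg,
      ← setIntegral_condExp hmΩ (integrable_indicator_one (hB.inter hE')) hg]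
    exact setIntegral_congr_ae (hmΩ _ hg) (hpull.mono fun ω h _ => h)
  have hind := condExp_indicator (μ := μ) (m := m') (integrable_indicator_one hB) hE
  rw [Set.indicator_indicator, Set.inter_comm] at hind
  filter_upwards [hkey, hind] with ω h1 h2 hω
  rw [h2, Set.indicator_of_mem hω, Set.indicator_of_mem hω] at h1
  exact h1.symm

theorem condExp_comp_measurePreserving [IsProbabilityMeasure μ] {T : Ω → Ω}
    (hT : MeasurePreserving T μ μ) (hm : m ≤ mΩ) {f : Ω → ℝ} (hf : Integrable f μ) :
    μ[f ∘ T | m.comap T] =ᵐ[μ] μ[f | m] ∘ T := by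
  have hm1 : m.comap T ≤ mΩ := (MeasurableSpace.comap_mono hm).trans hT.measurable.comap_le
  refine (ae_eq_condExp_of_forall_setIntegral_eq hm1 (hT.integrable_comp_of_integrable hf)
    (fun s _ _ => (hT.integrable_comp_of_integrable integrable_condExp).integrableOn)
    (fun s hs _ => ?_) ?_).symm
  · obtain ⟨t, ht, rfl⟩ := hs
    have e : ∀ g : Ω → ℝ, Integrable g μ →
        ∫ ω in T ⁻¹' t, (g ∘ T) ω ∂μ = ∫ ω in t, g ω ∂μ := by
      intro g hg
      conv_rhs => rw [← hT.map_eq]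
      rw [setIntegral_map (hm _ ht) (by rw [hT.map_eq]; exact hg.aestronglyMeasurable)
        hT.measurable.aemeasurable]
      rfl
    rw [e _ hf, e _ integrable_condExp, setIntegral_condExp hm hf ht]
  · exact (stronglyMeasurable_condExp.comp_measurable
      (comap_measurable T)).aestronglyMeasurable

theorem integral_condExp_mul_condExp_of_le [IsProbabilityMeasure μ] (hm : m ≤ m') (hm' : m' ≤ mΩ)
    {B : Set Ω} (hB : MeasurableSet B) :
    ∫ ω, (μ⟦B | m⟧) ω * (μ⟦B | m'⟧) ω ∂μ = ∫ ω, (μ⟦B | m⟧) ω ^ 2 ∂μ := by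
  have hmΩ := hm.trans hm'
  have h1 : μ[(μ⟦B | m⟧) * (μ⟦B | m'⟧) | m] =ᵐ[μ] (μ⟦B | m⟧) * (μ⟦B | m⟧) := by
    refine (condExp_stronglyMeasurable_mul_of_bound hmΩ stronglyMeasurable_condExp
      integrable_condExp 1 ?_).trans ?_
    · filter_upwards [condExp_indicator_mem_Icc (μ := μ) hmΩ hB] with ω h
      rw [Real.norm_of_nonneg h.1]; exact h.2
    · filter_upwards [condExp_condExp_of_le (μ := μ)
        (f := B.indicator fun _ => (1 : ℝ)) hm hm'] with ω h
      simp [h]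
  have h2 := integral_condExp (μ := μ) (f := (μ⟦B | m⟧) * (μ⟦B | m'⟧)) hmΩ
  rw [integral_congr_ae h1] at h2
  simp only [Pi.mul_apply] at h2
  simp only [← h2, sq]

theorem integrable_of_forall_mem_Icc [IsProbabilityMeasure μ] {f : Ω → ℝ} {φ : ℝ → ℝ}
    (hφ : Continuous φ) (hf : AEStronglyMeasurable f μ) (h : ∀ᵐ ω ∂μ, f ω ∈ Set.Icc (0 : ℝ) 1) :
    Integrable (fun ω => φ (f ω)) μ := by
  obtain ⟨C, hC⟩ := (isCompact_Icc (a := (0 : ℝ)) (b := 1)).exists_bound_of_continuousOn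
    hφ.continuousOn
  exact Integrable.of_bound (hφ.comp_aestronglyMeasurable hf) C (h.mono fun ω hω => hC _ hω)

theorem integrable_comp_condExp [IsProbabilityMeasure μ] {φ : ℝ → ℝ} (hφ : Continuous φ)
    (hm : m ≤ mΩ) {B : Set Ω} (hB : MeasurableSet B) :
    Integrable (fun ω => φ ((μ⟦B | m⟧) ω)) μ :=
  integrable_of_forall_mem_Icc hφ (stronglyMeasurable_condExp.mono hm).aestronglyMeasurable
    (condExp_indicator_mem_Icc hm hB)

/-- Pythagoras: the two conditional expectations are nested orthogonal projections. -/
theorem integral_sq_condExp_sub_condExp [IsProbabilityMeasure μ] (hm : m ≤ m') (hm' : m' ≤ mΩ)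
    {B : Set Ω} (hB : MeasurableSet B) :
    ∫ ω, ((μ⟦B | m'⟧) ω - (μ⟦B | m⟧) ω) ^ 2 ∂μ =
      ∫ ω, (μ⟦B | m'⟧) ω ^ 2 ∂μ - ∫ ω, (μ⟦B | m⟧) ω ^ 2 ∂μ := by
  have hmΩ := hm.trans hm'
  have i1 := integrable_comp_condExp (μ := μ) (continuous_pow 2) hm' hB
  have i2 := integrable_comp_condExp (μ := μ) (continuous_pow 2) hmΩ hB
  have i3 : Integrable (fun ω => (μ⟦B | m⟧) ω * (μ⟦B | m'⟧) ω) μ :=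
    integrable_condExp.bdd_mul (c := 1) (stronglyMeasurable_condExp.mono hmΩ).aestronglyMeasurable
      ((condExp_indicator_mem_Icc hmΩ hB).mono fun ω h => by
        rw [Real.norm_of_nonneg h.1]; exact h.2)
  have e : ∀ ω, ((μ⟦B | m'⟧) ω - (μ⟦B | m⟧) ω) ^ 2 =
      ((μ⟦B | m'⟧) ω ^ 2 + (μ⟦B | m⟧) ω ^ 2) - 2 * ((μ⟦B | m⟧) ω * (μ⟦B | m'⟧) ω) := by
    intro ω; ring
  simp_rw [e]
  have i12 : Integrable (fun ω => (μ⟦B | m'⟧) ω ^ 2 + (μ⟦B | m⟧) ω ^ 2) μ := i1.add i2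
  rw [integral_sub i12 (i3.const_mul 2), integral_add i1 i2, integral_const_mul,
    integral_condExp_mul_condExp_of_le hm hm' hB]
  ring

end CondExp

/-! ### Strong convexity: entropy gaps dominate squared distances. -/

section Entropy

/-- The second derivative of `x log x` is `1 / x ≥ 1` on the unit interval, leaving room to subtract
`x ^ 2 / 2`. -/
theorem convexOn_neg_negMulLog_sub_sq :
    ConvexOn ℝ (Set.Icc (0 : ℝ) 1) fun x => -Real.negMulLog x - x ^ 2 / 2 := by
  have hd : ∀ x ∈ Set.Ioo (0 : ℝ) 1,
      HasDerivAt (fun x => -Real.negMulLog x - x ^ 2 / 2) (Real.log x + 1 - x) x := by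
    intro x hx
    have h1 := (Real.hasDerivAt_negMulLog hx.1.ne').neg
    have h2 := ((hasDerivAt_id x).pow 2).div_const 2
    refine (h1.sub h2).congr_deriv ?_
    simp; ring
  refine MonotoneOn.convexOn_of_deriv (convex_Icc 0 1)
    (by fun_prop) ?_ ?_
  · rw [interior_Icc]
    exact fun x hx => (hd x hx).differentiableAt.differentiableWithinAt
  · rw [interior_Icc]
    intro x hx y hy hxy
    rw [(hd x hx).deriv, (hd y hy).deriv]
    have h1 : Real.log (y / x) ≥ 1 - (y / x)⁻¹ := Real.one_sub_inv_le_log_of_pos (div_pos hy.1 hx.1)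
    rw [Real.log_div hy.1.ne' hx.1.ne', inv_div] at h1
    have h2 : x / y ≤ 1 - (y - x) := by
      rw [div_le_iff₀ hy.1]
      nlinarith [hy.1, hy.2, hx.1, mul_nonneg (sub_nonneg.2 hxy) (sub_nonneg.2 hy.2.le)]
    linarith

variable {Ω : Type*} {m m' mΩ : MeasurableSpace Ω} {μ : Measure Ω}

/-- Conditional Jensen for the preceding convex function; by Pythagoras its quadratic part
contributes exactly the squared distance. -/
theorem integral_sq_le_integral_negMulLog_sub [IsProbabilityMeasure μ] (hm : m ≤ m')
    (hm' : m' ≤ mΩ) {B : Set Ω} (hB : MeasurableSet B) :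
    (∫ ω, ((μ⟦B | m'⟧) ω - (μ⟦B | m⟧) ω) ^ 2 ∂μ) / 2 ≤
      ∫ ω, Real.negMulLog ((μ⟦B | m⟧) ω) ∂μ - ∫ ω, Real.negMulLog ((μ⟦B | m'⟧) ω) ∂μ := by
  have hmΩ := hm.trans hm'
  have hc : Continuous fun x : ℝ => -Real.negMulLog x - x ^ 2 / 2 := by fun_prop
  have hj := convexOn_neg_negMulLog_sub_sq.map_condExp_le (μ := μ) hmΩ
    hc.continuousOn.lowerSemicontinuousOn (condExp_indicator_mem_Icc hm' hB) isClosed_Icc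
    integrable_condExp (integrable_comp_condExp hc hm' hB)
  have hj2 := integral_mono_ae ((integrable_comp_condExp hc hmΩ hB).congr ?_) integrable_condExp hj
  · rw [integral_condExp hmΩ] at hj2
    have e1 : ∫ ω, ((fun x : ℝ => -Real.negMulLog x - x ^ 2 / 2) ∘
        μ[μ⟦B | m'⟧ | m]) ω ∂μ = ∫ ω, (-Real.negMulLog ((μ⟦B | m⟧) ω) - (μ⟦B | m⟧) ω ^ 2 / 2) ∂μ := by
      refine integral_congr_ae ?_
      filter_upwards [condExp_condExp_of_le (μ := μ)
        (f := B.indicator fun _ => (1 : ℝ)) hm hm'] with ω h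
      simp [h]
    have e2 : ∀ k : MeasurableSpace Ω, k ≤ mΩ →
        ∫ ω, (-Real.negMulLog ((μ⟦B | k⟧) ω) - (μ⟦B | k⟧) ω ^ 2 / 2) ∂μ =
        - ∫ ω, Real.negMulLog ((μ⟦B | k⟧) ω) ∂μ - (∫ ω, (μ⟦B | k⟧) ω ^ 2 ∂μ) / 2 := by
      intro k hk
      rw [integral_sub (integrable_comp_condExp (φ := fun x => -Real.negMulLog x)
        (by fun_prop) hk hB)
        ((integrable_comp_condExp (continuous_pow 2) hk hB).div_const 2), integral_neg,
        integral_div]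
    rw [e1, e2 m hmΩ] at hj2
    have e3 := e2 m' hm'
    simp only [Function.comp_def] at hj2
    rw [e3] at hj2
    rw [integral_sq_condExp_sub_condExp hm hm' hB]
    linarith
  · filter_upwards [condExp_condExp_of_le (μ := μ)
      (f := B.indicator fun _ => (1 : ℝ)) hm hm'] with ω h
    simp [h]

end Entropy

/-! ### Conditional entropy and its chain rule. -/

section Entropy

variable {Ω : Type*} {m m' mΩ : MeasurableSpace Ω} {μ : Measure Ω}

theorem integral_indicator_eq_integral_condExp_mul [IsProbabilityMeasure μ] (hm : m ≤ mΩ)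
    {E : Set Ω} (hE : MeasurableSet[mΩ] E) {w : Ω → ℝ} (hw : StronglyMeasurable[m] w) {C : ℝ}
    (hwb : ∀ᵐ ω ∂μ, ‖w ω‖ ≤ C) :
    ∫ ω, E.indicator w ω ∂μ = ∫ ω, (μ⟦E | m⟧) ω * w ω ∂μ := by
  have h := condExp_stronglyMeasurable_mul_of_bound hm hw (integrable_indicator_one hE) C hwb
  have h2 := integral_condExp (μ := μ) (f := w * E.indicator fun _ => (1 : ℝ)) hm
  rw [integral_congr_ae h] at h2
  have e : E.indicator w = w * E.indicator fun _ => (1 : ℝ) := by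
    ext ω; by_cases h : ω ∈ E <;> simp [h]
  rw [e, ← h2]
  simp only [Pi.mul_apply, mul_comm]

/-- On `E` the finer conditional probability is `p / q`, with `p`, `q` those of `B ∩ E` and `E`
given `m`. Averaging over `E` gives the weight `q`, and `q * negMulLog (p / q) = negMulLog p + p *
log q`. -/
theorem integral_indicator_negMulLog_condExp [IsProbabilityMeasure μ] (hm : m ≤ m')
    (hm' : m' ≤ mΩ) {E B : Set Ω} (hE : MeasurableSet[m'] E) (hB : MeasurableSet B)
    (htr : m'.comap (Subtype.val : E → Ω) ≤ m.comap Subtype.val) :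
    Integrable (fun ω => (μ⟦B ∩ E | m⟧) ω * Real.log ((μ⟦E | m⟧) ω)) μ ∧
    ∫ ω, E.indicator (fun ω => Real.negMulLog ((μ⟦B | m'⟧) ω)) ω ∂μ =
      ∫ ω, Real.negMulLog ((μ⟦B ∩ E | m⟧) ω) ∂μ +
      ∫ ω, (μ⟦B ∩ E | m⟧) ω * Real.log ((μ⟦E | m⟧) ω) ∂μ := by
  have hmΩ := hm.trans hm'
  have hE' := hm' _ hE
  have h01 : ∀ᵐ ω ∂μ, 0 ≤ (μ⟦B ∩ E | m⟧) ω ∧ (μ⟦B ∩ E | m⟧) ω ≤ (μ⟦E | m⟧) ω ∧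
      (μ⟦E | m⟧) ω ≤ 1 := by
    filter_upwards [condExp_indicator_nonneg (μ := μ) m (B ∩ E),
      condExp_indicator_mono (μ := μ) m (hB.inter hE') hE' Set.inter_subset_right,
      condExp_indicator_mem_Icc (μ := μ) hmΩ hE']
      with ω h0 h1 h2 using ⟨h0, h1, h2.2⟩
  have hi : Integrable (fun ω => (μ⟦B ∩ E | m⟧) ω * Real.log ((μ⟦E | m⟧) ω)) μ := by
    refine (integrable_comp_condExp Real.continuous_negMulLog hmΩ hE').mono
      ((stronglyMeasurable_condExp.measurable.mul
        stronglyMeasurable_condExp.measurable.log).mono hmΩ le_rfl).aestronglyMeasurable ?_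
    filter_upwards [h01] with ω h
    rw [norm_mul, Real.negMulLog, norm_mul, norm_neg]
    gcongr
    rw [Real.norm_of_nonneg h.1, Real.norm_of_nonneg (h.1.trans h.2.1)]
    exact h.2.1
  refine ⟨hi, ?_⟩
  have hw : StronglyMeasurable[m]
      (fun ω => Real.negMulLog ((μ⟦B ∩ E | m⟧) ω / (μ⟦E | m⟧) ω)) :=
    (Real.continuous_negMulLog.measurable.comp (stronglyMeasurable_condExp.measurable.div
      stronglyMeasurable_condExp.measurable)).stronglyMeasurable
  obtain ⟨C, hC⟩ := (isCompact_Icc (a := (0 : ℝ)) (b := 1)).exists_bound_of_continuousOn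
    Real.continuous_negMulLog.continuousOn
  have hwb : ∀ᵐ ω ∂μ, ‖Real.negMulLog ((μ⟦B ∩ E | m⟧) ω / (μ⟦E | m⟧) ω)‖ ≤ C := by
    filter_upwards [h01] with ω h
    exact hC _ ⟨div_nonneg h.1 (h.1.trans h.2.1), div_le_one_of_le₀ h.2.1 (h.1.trans h.2.1)⟩
  have e1 : ∫ ω, E.indicator (fun ω => Real.negMulLog ((μ⟦B | m'⟧) ω)) ω ∂μ =
      ∫ ω, E.indicator (fun ω => Real.negMulLog ((μ⟦B ∩ E | m⟧) ω / (μ⟦E | m⟧) ω)) ω ∂μ := by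
    refine integral_congr_ae ?_
    filter_upwards [condExp_eq_div_of_comap_le hm hm' hE hB htr] with ω h
    by_cases hω : ω ∈ E
    · simp [hω, h hω]
    · simp [hω]
  rw [e1, integral_indicator_eq_integral_condExp_mul hmΩ hE' hw hwb,
    ← integral_add (integrable_comp_condExp Real.continuous_negMulLog hmΩ (hB.inter hE')) hi]
  refine integral_congr_ae ?_
  filter_upwards [h01] with ω h
  rcases h.1.eq_or_lt with h0 | h0
  · simp [← h0]
  · have hd := h0.trans_le h.2.1
    simp only [Real.negMulLog]
    rw [Real.log_div h0.ne' hd.ne']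
    field_simp
    ring

/-- Adjoining `X` adds no information on an event where `X` is constant. -/
theorem comap_sup_comap_val_preimage_le (m : MeasurableSpace Ω) {A : Type*} [MeasurableSpace A]
    (X : Ω → A) (a : A) :
    (m ⊔ MeasurableSpace.comap X inferInstance).comap
      (Subtype.val : (X ⁻¹' {a} : Set Ω) → Ω) ≤ m.comap Subtype.val := by
  rw [MeasurableSpace.comap_sup, MeasurableSpace.comap_comp]
  have : X ∘ (Subtype.val : (X ⁻¹' {a} : Set Ω) → Ω) = fun _ => a := funext fun x => x.2
  rw [this, MeasurableSpace.comap_const]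
  simp

variable {A : Type*} [Fintype A] [MeasurableSpace A] [DiscreteMeasurableSpace A]

/-- The conditional entropy of the finite-valued random variable `X` given the σ-algebra `m`. -/
noncomputable def condEntropy (μ : Measure Ω) (m : MeasurableSpace Ω) (X : Ω → A) : ℝ :=
  ∑ a, ∫ ω, Real.negMulLog ((μ⟦X ⁻¹' {a} | m⟧) ω) ∂μ

theorem sum_condExp_inter_preimage [IsProbabilityMeasure μ] {E : Set Ω}
    (hE : MeasurableSet[mΩ] E) {Y : Ω → A} (hY : Measurable[mΩ] Y) (m : MeasurableSpace Ω) :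
    ∀ᵐ ω ∂μ, ∑ b, (μ⟦Y ⁻¹' {b} ∩ E | m⟧) ω = (μ⟦E | m⟧) ω := by
  have h := condExp_finsetSum (μ := μ) (s := Finset.univ)
    (f := fun b => (Y ⁻¹' {b} ∩ E).indicator fun _ => (1 : ℝ))
    (fun b _ => integrable_indicator_one ((hY (measurableSet_singleton b)).inter hE)) m
  have e : ∑ b, (Y ⁻¹' {b} ∩ E).indicator (fun _ => (1 : ℝ)) = E.indicator fun _ => 1 := by
    classical
    ext ω
    rw [Finset.sum_apply]
    by_cases hω : ω ∈ E <;> simp [Set.indicator_apply, hω]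
  rw [e] at h
  filter_upwards [h] with ω h
  rw [h, Finset.sum_apply]

/-- Chain rule: the right side is the joint entropy. Summing the logarithmic terms over the values
of `Y` produces minus the entropy of `X`. -/
theorem condEntropy_add_condEntropy_sup [IsProbabilityMeasure μ] (hm : m ≤ mΩ) {X Y : Ω → A}
    (hX : Measurable[mΩ] X) (hY : Measurable[mΩ] Y) :
    condEntropy μ m X + condEntropy μ (m ⊔ MeasurableSpace.comap X inferInstance) Y =
      ∑ a, ∑ b, ∫ ω, Real.negMulLog ((μ⟦Y ⁻¹' {b} ∩ X ⁻¹' {a} | m⟧) ω) ∂μ := by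
  set m' := m ⊔ MeasurableSpace.comap X inferInstance with hm'def
  have hm' : m' ≤ mΩ := sup_le hm hX.comap_le
  have hXa : ∀ a, MeasurableSet[m'] (X ⁻¹' {a}) := fun a =>
    (le_sup_right : _ ≤ m') _ ⟨{a}, measurableSet_singleton a, rfl⟩
  have hYb : ∀ b, MeasurableSet[mΩ] (Y ⁻¹' {b}) := fun b => hY (measurableSet_singleton b)
  have key := fun a b => integral_indicator_negMulLog_condExp (μ := μ) le_sup_left hm' (hXa a)
    (hYb b) (comap_sup_comap_val_preimage_le m X a)
  have h1 : condEntropy μ m' Y = ∑ a, ∑ b,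
      ∫ ω, (X ⁻¹' {a}).indicator (fun ω => Real.negMulLog ((μ⟦Y ⁻¹' {b} | m'⟧) ω)) ω ∂μ := by
    rw [condEntropy, Finset.sum_comm]
    refine Finset.sum_congr rfl fun b _ => ?_
    rw [← integral_finsetSum]
    · refine integral_congr_ae (ae_of_all _ fun ω => ?_)
      classical
      simp [Set.indicator_apply]
    · exact fun a _ => (integrable_comp_condExp Real.continuous_negMulLog hm'
        (hYb b)).indicator (hm' _ (hXa a))
  have h2 : ∀ a, ∑ b, ∫ ω, (μ⟦Y ⁻¹' {b} ∩ X ⁻¹' {a} | m⟧) ω *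
      Real.log ((μ⟦X ⁻¹' {a} | m⟧) ω) ∂μ =
      - ∫ ω, Real.negMulLog ((μ⟦X ⁻¹' {a} | m⟧) ω) ∂μ := by
    intro a
    rw [← integral_finsetSum _ fun b _ => (key a b).1, ← integral_neg]
    refine integral_congr_ae ?_
    filter_upwards [sum_condExp_inter_preimage (hm' _ (hXa a)) hY m] with ω h
    rw [← Finset.sum_mul, h]
    simp [Real.negMulLog]
  rw [h1, condEntropy, ← Finset.sum_add_distrib]
  refine Finset.sum_congr rfl fun a _ => ?_
  rw [Finset.sum_congr rfl fun b _ => (key a b).2, Finset.sum_add_distrib, h2]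
  ring

theorem condEntropy_exchange [IsProbabilityMeasure μ] (hm : m ≤ mΩ) {X Y : Ω → A}
    (hX : Measurable[mΩ] X) (hY : Measurable[mΩ] Y) :
    condEntropy μ m X + condEntropy μ (m ⊔ MeasurableSpace.comap X inferInstance) Y =
      condEntropy μ m Y + condEntropy μ (m ⊔ MeasurableSpace.comap Y inferInstance) X := by
  rw [condEntropy_add_condEntropy_sup hm hX hY, condEntropy_add_condEntropy_sup hm hY hX,
    Finset.sum_comm]
  simp_rw [Set.inter_comm]

theorem sum_integral_sq_le_condEntropy_sub [IsProbabilityMeasure μ] (hm : m ≤ m')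
    (hm' : m' ≤ mΩ) {X : Ω → A} (hX : Measurable[mΩ] X) :
    ∑ a, (∫ ω, ((μ⟦X ⁻¹' {a} | m'⟧) ω - (μ⟦X ⁻¹' {a} | m⟧) ω) ^ 2 ∂μ) / 2 ≤
      condEntropy μ m X - condEntropy μ m' X := by
  rw [condEntropy, condEntropy, ← Finset.sum_sub_distrib]
  exact Finset.sum_le_sum fun a _ =>
    integral_sq_le_integral_negMulLog_sub hm hm' (hX (measurableSet_singleton a))

theorem condEntropy_anti [IsProbabilityMeasure μ] (hm : m ≤ m')
    (hm' : m' ≤ mΩ) {X : Ω → A} (hX : Measurable[mΩ] X) :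
    condEntropy μ m' X ≤ condEntropy μ m X := by
  have h := sum_integral_sq_le_condEntropy_sub (μ := μ) hm hm' hX
  have h2 : 0 ≤ ∑ a, (∫ ω, ((μ⟦X ⁻¹' {a} | m'⟧) ω - (μ⟦X ⁻¹' {a} | m⟧) ω) ^ 2 ∂μ) / 2 :=
    Finset.sum_nonneg fun a _ => div_nonneg (integral_nonneg fun ω => sq_nonneg _) (by norm_num)
  linarith

theorem condEntropy_comp_measurePreserving [IsProbabilityMeasure μ] {T : Ω → Ω}
    (hT : MeasurePreserving T μ μ) (hm : m ≤ mΩ) {X : Ω → A} (hX : Measurable[mΩ] X) :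
    condEntropy μ (m.comap T) (X ∘ T) = condEntropy μ m X := by
  refine Finset.sum_congr rfl fun a _ => ?_
  have hB := hX (measurableSet_singleton a)
  have h := condExp_comp_measurePreserving hT hm (integrable_indicator_one (μ := μ) hB)
  have e : ((X ∘ T) ⁻¹' {a}).indicator (fun _ => (1 : ℝ)) =
    (X ⁻¹' {a}).indicator (fun _ => (1 : ℝ)) ∘ T := rfl
  rw [e]
  conv_rhs => rw [← hT.map_eq]
  rw [integral_map hT.measurable.aemeasurable]
  · rw [hT.map_eq]
    exact integral_congr_ae (h.mono fun ω h => congrArg Real.negMulLog h)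
  · rw [hT.map_eq]
    exact (integrable_comp_condExp Real.continuous_negMulLog hm hB).aestronglyMeasurable

/-- Lévy's upward theorem, with dominated convergence since `negMulLog` is bounded on the unit
interval. -/
theorem tendsto_condEntropy [IsProbabilityMeasure μ] (ℱ : Filtration ℕ mΩ) {X : Ω → A}
    (hX : Measurable[mΩ] X) :
    Tendsto (fun n => condEntropy μ (ℱ n) X) atTop (𝓝 (condEntropy μ (⨆ n, ℱ n) X)) := by
  refine tendsto_finsetSum _ fun a _ => ?_
  have hB := hX (measurableSet_singleton a)
  obtain ⟨C, hC⟩ := (isCompact_Icc (a := (0 : ℝ)) (b := 1)).exists_bound_of_continuousOn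
    Real.continuous_negMulLog.continuousOn
  refine tendsto_integral_of_dominated_convergence (fun _ => C)
    (fun n => (integrable_comp_condExp Real.continuous_negMulLog (ℱ.le n) hB).aestronglyMeasurable)
    (integrable_const _) (fun n => ?_) ?_
  · exact (condExp_indicator_mem_Icc (μ := μ) (ℱ.le n) hB).mono fun ω h => hC _ h
  · filter_upwards [tendsto_ae_condExp (μ := μ) (ℱ := ℱ)
      ((X ⁻¹' {a}).indicator fun _ => (1 : ℝ))] with ω h
    exact (Real.continuous_negMulLog.tendsto _).comp h

end Entropy

/-! ### Stationary processes and the time-reversed entropy expansion. -/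

section StationaryProcesses

variable {Ω A : Type*} [MeasurableSpace A]

/-- The σ-algebra generated by the outcomes of the periods `i, …, j - 1`. -/
abbrev block (ξ : ℕ → Ω → A) (i j : ℕ) : MeasurableSpace Ω :=
  ⨆ k : ℕ, ⨆ _ : i ≤ k ∧ k < j, MeasurableSpace.comap (ξ k) inferInstance

/-- The σ-algebra generated by the outcomes from period `i` onwards. -/
abbrev future (ξ : ℕ → Ω → A) (i : ℕ) : MeasurableSpace Ω :=
  ⨆ k : ℕ, ⨆ _ : i ≤ k, MeasurableSpace.comap (ξ k) inferInstance

theorem comap_le_block {ξ : ℕ → Ω → A} {i j k : ℕ} (h : i ≤ k) (h' : k < j) :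
    MeasurableSpace.comap (ξ k) inferInstance ≤ block ξ i j :=
  le_iSup₂_of_le k ⟨h, h'⟩ le_rfl

theorem comap_le_future {ξ : ℕ → Ω → A} {i k : ℕ} (h : i ≤ k) :
    MeasurableSpace.comap (ξ k) inferInstance ≤ future ξ i :=
  le_iSup₂_of_le k h le_rfl

theorem block_le_future (ξ : ℕ → Ω → A) (i j : ℕ) : block ξ i j ≤ future ξ i :=
  iSup₂_le fun _ h => comap_le_future h.1

theorem block_mono (ξ : ℕ → Ω → A) {i i' j j' : ℕ} (hi : i' ≤ i) (hj : j ≤ j') :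
    block ξ i j ≤ block ξ i' j' :=
  iSup₂_le fun _ h => comap_le_block (hi.trans h.1) (h.2.trans_le hj)

theorem block_self (ξ : ℕ → Ω → A) (i : ℕ) : block ξ i i = ⊥ :=
  le_bot_iff.1 (iSup₂_le fun _ h => absurd h.2 (not_lt.2 h.1))

theorem block_succ_right (ξ : ℕ → Ω → A) {i j : ℕ} (h : i ≤ j) :
    block ξ i (j + 1) = block ξ i j ⊔ MeasurableSpace.comap (ξ j) inferInstance := by
  apply le_antisymm
  · refine iSup₂_le fun k hk => ?_
    rcases (Nat.lt_succ_iff.1 hk.2).lt_or_eq with hlt | rfl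
    · exact (comap_le_block hk.1 hlt).trans le_sup_left
    · exact le_sup_right
  · exact sup_le (block_mono ξ le_rfl j.le_succ) (comap_le_block h j.lt_succ_self)

theorem block_succ_left (ξ : ℕ → Ω → A) {i j : ℕ} (h : i < j) :
    block ξ i j = block ξ (i + 1) j ⊔ MeasurableSpace.comap (ξ i) inferInstance := by
  apply le_antisymm
  · refine iSup₂_le fun k hk => ?_
    rcases hk.1.lt_or_eq with hlt | rfl
    · exact (comap_le_block hlt hk.2).trans le_sup_left
    · exact le_sup_right
  · exact sup_le (block_mono ξ i.le_succ le_rfl) (comap_le_block le_rfl h)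

theorem iSup_block (ξ : ℕ → Ω → A) (i : ℕ) : ⨆ j, block ξ i (i + j) = future ξ i := by
  apply le_antisymm
  · exact iSup_le fun j => block_le_future ξ i _
  · exact iSup₂_le fun k hk => le_iSup_of_le (k - i + 1) (comap_le_block hk (by omega))

/-- `ξ` is the process obtained by observing a measure-preserving system. -/
structure IsStationaryProcess {mΩ : MeasurableSpace Ω} (T : Ω → Ω) (μ : Measure Ω)
    (ξ : ℕ → Ω → A) : Prop where
  measurePreserving : MeasurePreserving T μ μ
  measurable : ∀ n, Measurable (ξ n)
  comp_eq : ∀ n, ξ n ∘ T = ξ (n + 1)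

namespace IsStationaryProcess

variable {𝒯 mΩ : MeasurableSpace Ω} {T : Ω → Ω} {μ : Measure Ω} {ξ : ℕ → Ω → A}

theorem block_le (h : IsStationaryProcess T μ ξ) (i j : ℕ) : block ξ i j ≤ mΩ :=
  iSup₂_le fun k _ => (h.measurable k).comap_le

theorem future_le (h : IsStationaryProcess T μ ξ) (i : ℕ) : future ξ i ≤ mΩ :=
  iSup₂_le fun k _ => (h.measurable k).comap_le

theorem comp_iterate (h : IsStationaryProcess T μ ξ) (n k : ℕ) :
    ξ n ∘ T^[k] = ξ (n + k) := by
  induction k with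
  | zero => rfl
  | succ k ih => rw [Function.iterate_succ, ← Function.comp_assoc, ih, h.comp_eq, add_assoc]

theorem comap_block (h : IsStationaryProcess T μ ξ) (i j k : ℕ) :
    (block ξ i j).comap T^[k] = block ξ (i + k) (j + k) := by
  simp only [block, MeasurableSpace.comap_iSup, MeasurableSpace.comap_comp, h.comp_iterate]
  apply le_antisymm
  · exact iSup₂_le fun n hn => le_iSup₂_of_le (n + k) ⟨by omega, by omega⟩ le_rfl
  · refine iSup₂_le fun n hn => le_iSup₂_of_le (n - k) ⟨by omega, by omega⟩ ?_
    rw [Nat.sub_add_cancel (by omega)]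

theorem comap_future (h : IsStationaryProcess T μ ξ) (i k : ℕ) :
    (future ξ i).comap T^[k] = future ξ (i + k) := by
  simp only [future, MeasurableSpace.comap_iSup, MeasurableSpace.comap_comp, h.comp_iterate]
  apply le_antisymm
  · exact iSup₂_le fun n hn => le_iSup₂_of_le (n + k) (by omega) le_rfl
  · refine iSup₂_le fun n hn => le_iSup₂_of_le (n - k) (by omega) ?_
    rw [Nat.sub_add_cancel (by omega)]

variable [Fintype A] [DiscreteMeasurableSpace A] [IsProbabilityMeasure μ]

/-- The entropy of `(ξ 0, …, ξ (n - 1))` given `𝒯`, expanded forwards and backwards in time. -/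
theorem sum_condEntropy_eq (h : IsStationaryProcess T μ ξ) (h𝒯 : 𝒯 ≤ mΩ) (n : ℕ) :
    ∑ k ∈ Finset.range n, condEntropy μ (block ξ 0 k ⊔ 𝒯) (ξ k) =
      ∑ k ∈ Finset.range n, condEntropy μ (block ξ (k + 1) n ⊔ 𝒯) (ξ k) := by
  induction n with
  | zero => simp
  | succ n ih =>
    -- Exchanging `ξ k` and `ξ n` adds period `n` to the conditioning block. The corrections
    -- telescope, and their lower end, with conditioning block `block ξ n n = ⊥`, cancels the new
    -- term `k = n`.
    have hex : ∀ k ∈ Finset.range n, condEntropy μ (block ξ (k + 1) (n + 1) ⊔ 𝒯) (ξ k) =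
        condEntropy μ (block ξ (k + 1) n ⊔ 𝒯) (ξ k) +
        (condEntropy μ (block ξ k n ⊔ 𝒯) (ξ n) -
          condEntropy μ (block ξ (k + 1) n ⊔ 𝒯) (ξ n)) := by
      intro k hk
      have hk := Finset.mem_range.1 hk
      have := condEntropy_exchange (μ := μ) (m := block ξ (k + 1) n ⊔ 𝒯)
        (sup_le (h.block_le _ _) h𝒯) (h.measurable k) (h.measurable n)
      rw [sup_right_comm, ← block_succ_left ξ hk, sup_right_comm, ← block_succ_right ξ hk] at this
      linarith
    rw [Finset.sum_range_succ, Finset.sum_range_succ, Finset.sum_congr rfl hex,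
      Finset.sum_add_distrib,
      Finset.sum_range_sub' (fun k => condEntropy μ (block ξ k n ⊔ 𝒯) (ξ n)), ih, block_self,
      block_self]
    ring

theorem condEntropy_future (h : IsStationaryProcess T μ ξ) (k : ℕ) :
    condEntropy μ (future ξ (k + 1)) (ξ k) = condEntropy μ (future ξ 1) (ξ 0) := by
  have := condEntropy_comp_measurePreserving (h.measurePreserving.iterate k) (h.future_le 1)
    (h.measurable 0)
  rwa [h.comap_future, h.comp_iterate, zero_add, add_comm] at this

/-- After backward expansion, stationarity moves every term without `𝒯` to period `0`. With `𝒯`, the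
conditioning stays inside the whole future, so the entropy is at least that given the future.
Writing `⊔ ⊥` makes the case without `𝒯` an instance of the same expansion. -/
theorem sum_condEntropy_sub_le (h : IsStationaryProcess T μ ξ) (h𝒯 : ∀ k, 𝒯 ≤ future ξ k)
    (n : ℕ) :
    ∑ k ∈ Finset.range n, (condEntropy μ (block ξ 0 k ⊔ ⊥) (ξ k) -
      condEntropy μ (block ξ 0 k ⊔ 𝒯) (ξ k)) ≤
    ∑ k ∈ Finset.range n, (condEntropy μ (block ξ 1 (1 + k)) (ξ 0) -
      condEntropy μ (future ξ 1) (ξ 0)) := by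
  rw [Finset.sum_sub_distrib, Finset.sum_sub_distrib, h.sum_condEntropy_eq bot_le,
    h.sum_condEntropy_eq ((h𝒯 0).trans (h.future_le 0)),
    -- Period `k` sees the `n - 1 - k` outcomes after it, so the order of summation is reversed.
    ← Finset.sum_range_reflect (fun k => condEntropy μ (block ξ 1 (1 + k)) (ξ 0))]
  refine sub_le_sub (le_of_eq ?_) ?_
  · refine Finset.sum_congr rfl fun k hk => ?_
    have hk := Finset.mem_range.1 hk
    have := condEntropy_comp_measurePreserving (h.measurePreserving.iterate k)
      (h.block_le 1 (1 + (n - 1 - k))) (h.measurable 0)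
    rw [h.comap_block, h.comp_iterate, zero_add] at this
    rw [← this, sup_bot_eq, add_comm 1 k]
    congr 2
    omega
  · refine Finset.sum_le_sum fun k _ => ?_
    rw [← h.condEntropy_future k]
    exact condEntropy_anti (sup_le (block_le_future ξ _ _) (h𝒯 _)) (h.future_le _)
      (h.measurable k)

end IsStationaryProcess

/-- Otherwise `u ≥ ε` and `v < ε / 2` from some index on, and the partial sums of `u - v` grow
linearly. -/
theorem frequently_lt_of_sum_le_sum {u v : ℕ → ℝ} (hv : Tendsto v atTop (𝓝 0))
    (h : ∀ n, ∑ k ∈ Finset.range n, u k ≤ ∑ k ∈ Finset.range n, v k) {ε : ℝ} (hε : 0 < ε) :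
    ∃ᶠ k in atTop, u k < ε := by
  intro hcon
  obtain ⟨K, hK⟩ := eventually_atTop.1
    (hcon.and (hv.eventually (gt_mem_nhds (half_pos hε))))
  have hlow : ∀ j : ℕ, ∑ k ∈ Finset.range K, (u k - v k) + j * (ε / 2) ≤
      ∑ k ∈ Finset.range (K + j), (u k - v k) := by
    intro j
    induction j with
    | zero => simp
    | succ j ih =>
      rw [← add_assoc, Finset.sum_range_succ]
      have := hK (K + j) (by omega)
      push_cast
      linarith [not_lt.1 this.1, this.2]
  obtain ⟨j, hj⟩ := exists_nat_gt ((-∑ k ∈ Finset.range K, (u k - v k)) / (ε / 2))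
  rw [div_lt_iff₀ (half_pos hε)] at hj
  have h1 := hlow j
  have h2 := h (K + j)
  rw [Finset.sum_sub_distrib] at h1
  rw [Finset.sum_sub_distrib] at hj
  rw [Finset.sum_sub_distrib] at h1
  linarith

namespace IsStationaryProcess

variable {𝒯 mΩ : MeasurableSpace Ω} {T : Ω → Ω} {μ : Measure Ω} {ξ : ℕ → Ω → A}
  [Fintype A] [DiscreteMeasurableSpace A] [IsProbabilityMeasure μ]

/-- The predictions of the next outcome from a long past are hardly improved by the knowledge of
the tail. -/
theorem frequently_integral_sq_lt (h : IsStationaryProcess T μ ξ) (h𝒯 : ∀ k, 𝒯 ≤ future ξ k)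
    (a : A) {ε : ℝ} (hε : 0 < ε) :
    ∃ᶠ k in atTop, ∫ ω, ((μ⟦ξ k ⁻¹' {a} | block ξ 0 k ⊔ 𝒯⟧) ω -
      (μ⟦ξ k ⁻¹' {a} | block ξ 0 k ⊔ ⊥⟧) ω) ^ 2 ∂μ < ε := by
  let ℱ : Filtration ℕ mΩ :=
    ⟨fun j => block ξ 1 (1 + j), fun i j hij => block_mono ξ le_rfl (by omega),
      fun j => h.block_le _ _⟩
  have hlim : Tendsto (fun j => condEntropy μ (block ξ 1 (1 + j)) (ξ 0) -
      condEntropy μ (future ξ 1) (ξ 0)) atTop (𝓝 0) := by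
    have := tendsto_condEntropy (μ := μ) ℱ (h.measurable 0)
    rw [show ⨆ n, ℱ n = future ξ 1 from iSup_block ξ 1] at this
    simpa using this.sub_const (condEntropy μ (future ξ 1) (ξ 0))
  refine (frequently_lt_of_sum_le_sum hlim (h.sum_condEntropy_sub_le h𝒯) (half_pos hε)).mono
    fun k hk => ?_
  have h𝒯' := (h𝒯 0).trans (h.future_le 0)
  have h1 := sum_integral_sq_le_condEntropy_sub (μ := μ) (m := block ξ 0 k ⊔ ⊥)
    (m' := block ξ 0 k ⊔ 𝒯) (sup_le_sup_left bot_le _) (sup_le (h.block_le _ _) h𝒯')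
    (h.measurable k)
  have h2 := Finset.single_le_sum (f := fun a => (∫ ω, ((μ⟦ξ k ⁻¹' {a} | block ξ 0 k ⊔ 𝒯⟧) ω -
      (μ⟦ξ k ⁻¹' {a} | block ξ 0 k ⊔ ⊥⟧) ω) ^ 2 ∂μ) / 2)
    (fun a _ => div_nonneg (integral_nonneg fun ω => sq_nonneg _) (by norm_num))
    (Finset.mem_univ a)
  linarith

end IsStationaryProcess

end StationaryProcesses

/-! ### Maximal inequalities: ergodic and martingale. -/

section Maximal

variable {Ω : Type*} {mΩ : MeasurableSpace Ω} {μ : Measure Ω}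

/-- **Maximal ergodic inequality** for a nonnegative function. -/
theorem measureReal_maximal_ergodic_le [IsProbabilityMeasure μ] {T : Ω → Ω}
    (hT : MeasurePreserving T μ μ) {f : Ω → ℝ} (hfm : Measurable f) (hf : Integrable f μ)
    (hf0 : 0 ≤ f) (ε : ℝ) (L : ℕ) :
    ε * μ.real {ω | ∃ N ∈ Finset.range (L + 1), ε * N < ∑ n ∈ Finset.range N, f (T^[n] ω)} ≤
      ∫ ω, f ω ∂μ := by
  let g : Ω → ℝ := fun ω => f ω - ε
  have hgi : Integrable g μ := hf.sub (integrable_const _)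
  have hgm : Measurable g := hfm.sub_const _
  -- The empty sum `N = 0` is included, which makes `M` nonnegative.
  let M : Ω → ℝ := fun ω =>
    (Finset.range (L + 1)).sup' Finset.nonempty_range_add_one fun N => birkhoffSum T g N ω
  have hSi : ∀ N, Integrable (birkhoffSum T g N) μ := fun N =>
    integrable_finsetSum _ fun n _ => (hT.iterate n).integrable_comp_of_integrable hgi
  have hSm : ∀ N, Measurable (birkhoffSum T g N) := fun N =>
    Finset.measurable_sum _ fun n _ => hgm.comp (hT.iterate n).measurable
  have hM0 : ∀ ω, 0 ≤ M ω := fun ω => by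
    have := Finset.le_sup' (fun N => birkhoffSum T g N ω)
      (Finset.mem_range.2 (Nat.succ_pos L))
    simpa using this
  have hMm : Measurable M := Finset.measurable_range_sup'' fun N _ => hSm N
  have hMi : Integrable M μ := by
    refine (integrable_finsetSum (Finset.range (L + 1)) fun N _ => (hSi N).norm).mono'
      hMm.aestronglyMeasurable (ae_of_all _ fun ω => ?_)
    rw [Real.norm_of_nonneg (hM0 ω)]
    refine Finset.sup'_le _ _ fun N hN => (Real.le_norm_self _).trans ?_
    exact Finset.single_le_sum (f := fun N => ‖birkhoffSum T g N ω‖) (fun _ _ => norm_nonneg _) hN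
  have hMT : Integrable (fun ω => M (T ω)) μ := hT.integrable_comp_of_integrable hMi
  have hint : ∫ ω, M (T ω) ∂μ = ∫ ω, M ω ∂μ := by
    conv_rhs => rw [← hT.map_eq]
    rw [integral_map hT.measurable.aemeasurable hMm.aestronglyMeasurable]
  let E : Set Ω := {ω | 0 < M ω}
  have hE : MeasurableSet E := measurableSet_lt measurable_const hMm
  have hset : {ω | ∃ N ∈ Finset.range (L + 1),
      ε * N < ∑ n ∈ Finset.range N, f (T^[n] ω)} = E := by
    ext ω
    simp only [Set.mem_ofPred_eq, E, M, Finset.lt_sup'_iff]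
    refine exists_congr fun N => and_congr_right fun _ => ?_
    simp only [birkhoffSum, g, Finset.sum_sub_distrib, Finset.sum_const, Finset.card_range,
      nsmul_eq_mul, sub_pos, mul_comm]
  -- Garsia's step: where `M` is positive, its maximum is attained at a nonempty sum, and removing
  -- the first term leaves a competitor for `M (T ω)`.
  have hpt : ∀ ω, M ω - M (T ω) ≤ E.indicator g ω := by
    intro ω
    by_cases hω : ω ∈ E
    · rw [Set.indicator_of_mem hω]
      obtain ⟨N, hN, hMN⟩ := Finset.exists_mem_eq_sup' Finset.nonempty_range_add_one
        fun N => birkhoffSum T g N ω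
      have hMN : M ω = birkhoffSum T g N ω := hMN
      have hpos : 0 < birkhoffSum T g N ω := hMN ▸ hω
      cases N with
      | zero => simp at hpos
      | succ N =>
        rw [birkhoffSum_succ'] at hMN
        have : birkhoffSum T g N (T ω) ≤ M (T ω) :=
          Finset.le_sup' (fun N => birkhoffSum T g N (T ω))
            (Finset.mem_range.2 ((Nat.lt_succ_self N).trans (Finset.mem_range.1 hN)))
        linarith
    · rw [Set.indicator_of_notMem hω]
      have h1 : M ω ≤ 0 := not_lt.1 hω
      linarith [hM0 (T ω)]
  have h1 := integral_mono (hMi.sub hMT) (hgi.indicator hE) hpt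
  have h2 : ∫ ω, (M - fun ω => M (T ω)) ω ∂μ = 0 := by
    rw [integral_sub' hMi hMT, hint, sub_self]
  rw [h2, integral_indicator hE, integral_sub hf.integrableOn (integrable_const _),
    setIntegral_const, smul_eq_mul] at h1
  have h3 := setIntegral_le_integral (s := E) hf (ae_of_all _ hf0)
  rw [hset]
  linarith

theorem submartingale_abs {ℱ : Filtration ℕ mΩ} {M : ℕ → Ω → ℝ} (hM : Martingale M ℱ μ) :
    Submartingale (fun n ω => |M n ω|) ℱ μ :=
  hM.submartingale.sup hM.neg.submartingale

/-- Young's inequality: `|f|` is at most `η ^ 2 / 2 + f ^ 2 / (2 * η ^ 2)`. -/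
theorem integral_abs_le_of_integral_sq_le [IsProbabilityMeasure μ] {f : Ω → ℝ}
    (hf : Integrable f μ) (hf2 : Integrable (fun ω => f ω ^ 2) μ) {η : ℝ} (hη : 0 < η)
    (h : ∫ ω, f ω ^ 2 ∂μ ≤ η ^ 4) : ∫ ω, |f ω| ∂μ ≤ η ^ 2 := by
  have hp : ∀ ω, |f ω| ≤ η ^ 2 / 2 + f ω ^ 2 * (1 / (2 * η ^ 2)) := by
    intro ω
    have h1 : 0 ≤ (|f ω| - η ^ 2) ^ 2 := sq_nonneg _
    have h2 : η ^ 2 / 2 + f ω ^ 2 * (1 / (2 * η ^ 2)) - |f ω| =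
        (|f ω| - η ^ 2) ^ 2 / (2 * η ^ 2) := by
      rw [sub_sq, sq_abs]; field_simp; ring
    have h3 : 0 ≤ (|f ω| - η ^ 2) ^ 2 / (2 * η ^ 2) := by positivity
    linarith
  have h1 := integral_mono hf.abs ((integrable_const (η ^ 2 / 2)).add (hf2.mul_const _)) hp
  rw [integral_add' (integrable_const _) (hf2.mul_const _), integral_mul_const,
    integral_const, probReal_univ, one_smul] at h1
  have h3 : (∫ ω, f ω ^ 2 ∂μ) * (1 / (2 * η ^ 2)) ≤ η ^ 4 * (1 / (2 * η ^ 2)) := by gcongr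
  have h4 : η ^ 4 * (1 / (2 * η ^ 2)) = η ^ 2 / 2 := by field_simp
  linarith

/-- A martingale of conditional probabilities which moves little in `L²` has small maximal
displacement. -/
theorem exists_dominating_condExp_sub [IsProbabilityMeasure μ] (ℱ : Filtration ℕ mΩ)
    {B : Set Ω} (hB : MeasurableSet B) (n : ℕ) {η : ℝ} (hη : 0 < η)
    (h : ∫ ω, ((μ⟦B | ℱ n⟧) ω - (μ⟦B | ℱ 0⟧) ω) ^ 2 ∂μ ≤ η ^ 4) :
    ∃ Y : Ω → ℝ, Measurable Y ∧ Integrable Y μ ∧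
      (∀ k ≤ n, ∀ ω, |(μ⟦B | ℱ k⟧) ω - (μ⟦B | ℱ 0⟧) ω| ≤ Y ω) ∧ ∫ ω, Y ω ∂μ ≤ 2 * η := by
  let D : ℕ → Ω → ℝ := fun k ω => (μ⟦B | ℱ k⟧) ω - (μ⟦B | ℱ 0⟧) ω
  let Y : Ω → ℝ := fun ω => (Finset.range (n + 1)).sup' Finset.nonempty_range_add_one
      fun k => |D k ω|
  have hDm : ∀ k, Measurable (D k) := fun k =>
    ((stronglyMeasurable_condExp.mono (ℱ.le k)).measurable).sub
      ((stronglyMeasurable_condExp.mono (ℱ.le 0)).measurable)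
  have hYm : Measurable Y := Finset.measurable_range_sup'' fun k _ => (hDm k).abs
  have hmart : Martingale D ℱ μ := by
    refine (martingale_condExp _ ℱ μ).sub (martingale_const_fun ℱ μ ?_ integrable_condExp)
    exact stronglyMeasurable_condExp.mono (ℱ.mono bot_le)
  have hY01 : ∀ᵐ ω ∂μ, 0 ≤ Y ω ∧ Y ω ≤ 1 := by
    have := ae_all_iff.2 fun k => condExp_indicator_mem_Icc (μ := μ) (ℱ.le k) hB
    filter_upwards [this] with ω hω
    constructor
    · exact (abs_nonneg (D 0 ω)).trans (Finset.le_sup' (fun k => |D k ω|) (by simp))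
    · refine Finset.sup'_le _ _ fun k _ => ?_
      have h1 := hω k
      have h2 := hω 0
      exact abs_sub_le_iff.2 ⟨by linarith [h1.2, h2.1], by linarith [h1.1, h2.2]⟩
  have hYi : Integrable Y μ := Integrable.of_bound hYm.aestronglyMeasurable 1
    (hY01.mono fun ω h => by rw [Real.norm_of_nonneg h.1]; exact h.2)
  refine ⟨Y, hYm, hYi, fun k hk ω => Finset.le_sup' (fun k => |D k ω|)
    (Finset.mem_range.2 (Nat.lt_succ_of_le hk)), ?_⟩
  -- Doob's inequality at level `η` bounds the mass of `S` by `η ^ 2 / η = η`. Almost surely `Y ≤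
  -- 1`, and `Y < η` off `S`, whence `2 * η`.
  let S : Set Ω := {ω | η ≤ Y ω}
  have hS : MeasurableSet S := measurableSet_le measurable_const hYm
  have hmax := maximal_ineq (submartingale_abs hmart) (fun _ _ => abs_nonneg _)
    (ε := ⟨η, hη.le⟩) n
  change _ * μ S ≤ ENNReal.ofReal (∫ ω in S, |D n ω| ∂μ) at hmax
  have hDi : Integrable (D n) μ := hmart.integrable n
  have hD2 : Integrable (fun ω => D n ω ^ 2) μ := by
    refine Integrable.of_bound ((hDm n).pow_const 2).aestronglyMeasurable 1 ?_
    filter_upwards [condExp_indicator_mem_Icc (μ := μ) (ℱ.le n) hB,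
      condExp_indicator_mem_Icc (μ := μ) (ℱ.le 0) hB] with ω h1 h2
    rw [Real.norm_of_nonneg (sq_nonneg _), sq_le_one_iff_abs_le_one]
    exact abs_sub_le_iff.2 ⟨by linarith [h1.2, h2.1], by linarith [h1.1, h2.2]⟩
  have hD1 : ∫ ω in S, |D n ω| ∂μ ≤ η ^ 2 :=
    (setIntegral_le_integral hDi.abs (ae_of_all _ fun _ => abs_nonneg _)).trans
      (integral_abs_le_of_integral_sq_le hDi hD2 hη h)
  have hSη : μ.real S ≤ η := by
    have h1 := ENNReal.toReal_mono ENNReal.ofReal_ne_top hmax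
    rw [ENNReal.toReal_mul, ENNReal.toReal_ofReal
      (integral_nonneg fun _ => abs_nonneg _)] at h1
    have h2 : η * μ.real S ≤ η ^ 2 := h1.trans hD1
    nlinarith
  have hYle : Y ≤ᵐ[μ] fun ω => η + S.indicator (fun _ => (1 : ℝ)) ω := by
    filter_upwards [hY01] with ω hω
    by_cases hωS : ω ∈ S
    · rw [Set.indicator_of_mem hωS]; linarith [hω.2]
    · rw [Set.indicator_of_notMem hωS, add_zero]; exact (not_le.1 hωS).le
  have h1 := integral_mono_ae hYi ((integrable_const η).add (integrable_indicator_one hS)) hYle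
  rw [integral_add' (integrable_const _) (integrable_indicator_one hS),
    integral_indicator_const _ hS] at h1
  simp at h1
  linarith

end Maximal

/-! ### From mean control to almost sure Cesàro convergence. -/

section Maker

variable {Ω A : Type*} [MeasurableSpace A]

/-- The conditional probability of the outcome `a` in period `n` given the outcomes of the periods
`i, …, n - 1` and the σ-algebra `𝒯`. -/
noncomputable def condPred {mΩ : MeasurableSpace Ω} (μ : Measure Ω) (ξ : ℕ → Ω → A)
    (𝒯 : MeasurableSpace Ω) (a : A) (i n : ℕ) : Ω → ℝ :=
  μ⟦ξ n ⁻¹' {a} | block ξ i n ⊔ 𝒯⟧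

theorem integral_eq_of_ae_eq_comp {mΩ : MeasurableSpace Ω} {μ : Measure Ω} {T : Ω → Ω}
    (hT : MeasurePreserving T μ μ) {f g : Ω → ℝ} (hf : Measurable f) (hfg : g =ᵐ[μ] f ∘ T) :
    ∫ ω, g ω ∂μ = ∫ ω, f ω ∂μ := by
  rw [integral_congr_ae hfg]
  conv_rhs => rw [← hT.map_eq]
  rw [integral_map hT.measurable.aemeasurable hf.aestronglyMeasurable]
  rfl

namespace IsStationaryProcess

variable {𝒯 mΩ : MeasurableSpace Ω} {T : Ω → Ω} {μ : Measure Ω} {ξ : ℕ → Ω → A}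

theorem measurable_condPred (h : IsStationaryProcess T μ ξ) (h𝒯 : 𝒯 ≤ mΩ) (a : A) (i n : ℕ) :
    Measurable (condPred μ ξ 𝒯 a i n) :=
  (stronglyMeasurable_condExp.mono (sup_le (h.block_le i n) h𝒯)).measurable

variable [DiscreteMeasurableSpace A] [IsProbabilityMeasure μ]

theorem condPred_mem_Icc (h : IsStationaryProcess T μ ξ) (h𝒯 : 𝒯 ≤ mΩ) (a : A) (i n : ℕ) :
    ∀ᵐ ω ∂μ, condPred μ ξ 𝒯 a i n ω ∈ Set.Icc (0 : ℝ) 1 :=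
  condExp_indicator_mem_Icc (sup_le (h.block_le i n) h𝒯)
    (h.measurable n (measurableSet_singleton a))

theorem condPred_add (h : IsStationaryProcess T μ ξ) (h𝒯 : 𝒯 ≤ mΩ) (hinv : 𝒯.comap T = 𝒯)
    (a : A) (i n k : ℕ) :
    condPred μ ξ 𝒯 a (i + k) (n + k) =ᵐ[μ] condPred μ ξ 𝒯 a i n ∘ T^[k] := by
  have hk : 𝒯.comap T^[k] = 𝒯 := by
    induction k with
    | zero => simp
    | succ k ih => rw [Function.iterate_succ', ← MeasurableSpace.comap_comp, hinv, ih]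
  have := condExp_comp_measurePreserving (h.measurePreserving.iterate k)
    (sup_le (h.block_le i n) h𝒯) (integrable_indicator_one (μ := μ)
      (h.measurable n (measurableSet_singleton a)))
  rw [MeasurableSpace.comap_sup, hk, h.comap_block] at this
  have e : (ξ n ⁻¹' {a}).indicator (fun _ => (1 : ℝ)) ∘ T^[k] =
      (ξ (n + k) ⁻¹' {a}).indicator fun _ => 1 := by
    rw [← h.comp_iterate]; rfl
  rwa [e] at this

/-- Pythagoras, after which stationarity moves the window `L - m, …, L - 1` to `0, …, m - 1`. -/
theorem integral_sq_condPred_sub (h : IsStationaryProcess T μ ξ) (h𝒯 : 𝒯 ≤ mΩ)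
    (hinv : 𝒯.comap T = 𝒯) (a : A) {m L : ℕ} (hmL : m ≤ L) :
    ∫ ω, (condPred μ ξ 𝒯 a 0 L ω - condPred μ ξ 𝒯 a (L - m) L ω) ^ 2 ∂μ =
      ∫ ω, condPred μ ξ 𝒯 a 0 L ω ^ 2 ∂μ - ∫ ω, condPred μ ξ 𝒯 a 0 m ω ^ 2 ∂μ := by
  have h1 := integral_sq_condExp_sub_condExp (μ := μ)
    (sup_le_sup_right (block_mono ξ (Nat.zero_le (L - m)) le_rfl) 𝒯)
    (sup_le (h.block_le 0 L) h𝒯) (h.measurable L (measurableSet_singleton a))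
  have h2 := h.condPred_add h𝒯 hinv a 0 m (L - m)
  rw [zero_add, Nat.add_sub_cancel' hmL] at h2
  have h3 : ∫ ω, condPred μ ξ 𝒯 a (L - m) L ω ^ 2 ∂μ = ∫ ω, condPred μ ξ 𝒯 a 0 m ω ^ 2 ∂μ :=
    integral_eq_of_ae_eq_comp (h.measurePreserving.iterate (L - m))
      ((h.measurable_condPred h𝒯 a 0 m).pow_const 2)
      (h2.mono fun ω hω => by simp only [hω, Function.comp_apply])
  rw [← h3]
  exact h1

/-- The second moments `V` increase and are bounded by `1`; once `V m` is within `δ` of the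
supremum, no longer window can add more. -/
theorem eventually_integral_sq_condPred_sub_le (h : IsStationaryProcess T μ ξ) (h𝒯 : 𝒯 ≤ mΩ)
    (hinv : 𝒯.comap T = 𝒯) (a : A) {δ : ℝ} (hδ : 0 < δ) :
    ∀ᶠ m in atTop, ∀ L ≥ m,
      ∫ ω, (condPred μ ξ 𝒯 a 0 L ω - condPred μ ξ 𝒯 a (L - m) L ω) ^ 2 ∂μ ≤ δ := by
  let V : ℕ → ℝ := fun n => ∫ ω, condPred μ ξ 𝒯 a 0 n ω ^ 2 ∂μ
  have hV : Monotone V := fun m L hmL => by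
    have h1 := h.integral_sq_condPred_sub h𝒯 hinv a hmL
    have h2 : 0 ≤ ∫ ω, (condPred μ ξ 𝒯 a 0 L ω - condPred μ ξ 𝒯 a (L - m) L ω) ^ 2 ∂μ :=
      integral_nonneg fun ω => sq_nonneg _
    simp only [V]
    linarith
  have hb : BddAbove (Set.range V) := by
    refine ⟨1, ?_⟩
    rintro _ ⟨n, rfl⟩
    have h1 : V n ≤ ∫ _, (1 : ℝ) ∂μ := by
      refine integral_mono_of_nonneg (ae_of_all _ fun _ => sq_nonneg _) (integrable_const _) ?_
      filter_upwards [h.condPred_mem_Icc h𝒯 a 0 n] with ω hω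
      exact pow_le_one₀ hω.1 hω.2
    simpa using h1
  have hlim := tendsto_atTop_ciSup hV hb
  filter_upwards [hlim.eventually (lt_mem_nhds (sub_lt_self _ hδ))] with m hm L hL
  rw [h.integral_sq_condPred_sub h𝒯 hinv a hL]
  have := le_ciSup hb L
  simp only [V] at this hm
  linarith

theorem exists_dominating_condPred_sub (h : IsStationaryProcess T μ ξ) (h𝒯 : 𝒯 ≤ mΩ)
    (a : A) {m L : ℕ} (hmL : m ≤ L) {η : ℝ} (hη : 0 < η)
    (hle : ∫ ω, (condPred μ ξ 𝒯 a 0 L ω - condPred μ ξ 𝒯 a (L - m) L ω) ^ 2 ∂μ ≤ η ^ 4) :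
    ∃ Y : Ω → ℝ, Measurable Y ∧ Integrable Y μ ∧
      (∀ n, m ≤ n → n ≤ L → ∀ ω,
        |condPred μ ξ 𝒯 a (L - n) L ω - condPred μ ξ 𝒯 a (L - m) L ω| ≤ Y ω) ∧
      ∫ ω, Y ω ∂μ ≤ 2 * η := by
  -- For the fixed target `L`, the windows grow into the past; truncated subtraction stops them at
  -- period `0`.
  let ℱ : Filtration ℕ mΩ :=
    ⟨fun k => block ξ (L - m - k) L ⊔ 𝒯,
      fun i j hij => sup_le_sup_right (block_mono ξ (by omega) le_rfl) _,
      fun k => sup_le (h.block_le _ _) h𝒯⟩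
  have e : ∀ k, μ⟦ξ L ⁻¹' {a} | ℱ k⟧ = condPred μ ξ 𝒯 a (L - m - k) L := fun k => rfl
  obtain ⟨Y, hYm, hYi, hY, hYint⟩ := exists_dominating_condExp_sub (μ := μ) ℱ
    (h.measurable L (measurableSet_singleton a)) (L - m) hη (by
      rw [e, e, Nat.sub_self]
      exact hle)
  refine ⟨Y, hYm, hYi, fun n hmn hnL ω => ?_, hYint⟩
  have := hY (n - m) (by omega) ω
  rwa [e, e, show L - m - (n - m) = L - n by omega] at this

/-- A maximal inequality for the Cesàro averages of the distance between the predictions with and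
without knowledge of `𝒯`. -/
theorem measureReal_exists_lt_sum_le (h : IsStationaryProcess T μ ξ) (h𝒯 : 𝒯 ≤ mΩ)
    (hinv : 𝒯.comap T = 𝒯) (a : A) {m L : ℕ} (hmL : m ≤ L) {η : ℝ} (hη : 0 < η) (hη1 : η ≤ 1)
    (hle : ∫ ω, (condPred μ ξ 𝒯 a 0 L ω - condPred μ ξ 𝒯 a (L - m) L ω) ^ 2 ∂μ ≤ η ^ 4)
    (hle' : ∫ ω, (condPred μ ξ ⊥ a 0 L ω - condPred μ ξ ⊥ a (L - m) L ω) ^ 2 ∂μ ≤ η ^ 4)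
    (hgap : ∫ ω, (condPred μ ξ 𝒯 a 0 m ω - condPred μ ξ ⊥ a 0 m ω) ^ 2 ∂μ ≤ η ^ 4) (ε : ℝ)
    (hε : 0 ≤ ε) :
    ε * μ.real {ω | ∃ N ∈ Finset.range (L + 1), ε * N < ∑ n ∈ Finset.Ico m N,
      |condPred μ ξ ⊥ a 0 n ω - condPred μ ξ 𝒯 a 0 n ω|} ≤ 5 * η := by
  have hbinv : (⊥ : MeasurableSpace Ω).comap T = ⊥ := MeasurableSpace.comap_bot
  obtain ⟨Y, hYm, hYi, hY, hYint⟩ := h.exists_dominating_condPred_sub h𝒯 a hmL hη hle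
  obtain ⟨Z, hZm, hZi, hZ, hZint⟩ := h.exists_dominating_condPred_sub bot_le a hmL hη hle'
  have hm1 := fun i n => h.measurable_condPred (𝒯 := ⊥) bot_le a i n
  have hm2 := fun i n => h.measurable_condPred h𝒯 a i n
  have hci : ∀ 𝒮 i n, Integrable (condPred μ ξ 𝒮 a i n) μ := fun 𝒮 i n => integrable_condExp
  let D : ℕ → ℕ → Ω → ℝ := fun i n ω => |condPred μ ξ ⊥ a i n ω - condPred μ ξ 𝒯 a i n ω|
  have hDm : ∀ i n, Measurable (D i n) := fun i n => ((hm1 i n).sub (hm2 i n)).abs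
  have hDadd : ∀ i n k, D (i + k) (n + k) =ᵐ[μ] D i n ∘ T^[k] := by
    intro i n k
    filter_upwards [h.condPred_add h𝒯 hinv a i n k, h.condPred_add bot_le hbinv a i n k]
      with ω h1 h2
    simp only [D, h1, h2, Function.comp_apply]
  have hDi : ∀ i n, Integrable (D i n) μ := fun i n =>
    ((hci ⊥ i n).sub (hci 𝒯 i n)).abs
  let W : Ω → ℝ := fun ω => Y ω + Z ω + D (L - m) L ω
  have hWm : Measurable W := (hYm.add hZm).add (hDm _ _)
  have hWi : Integrable W μ := (hYi.add hZi).add (hDi _ _)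
  have hW : ∀ n, m ≤ n → n ≤ L → ∀ ω, D (L - n) L ω ≤ W ω := by
    intro n hmn hnL ω
    have h1 := abs_le.1 (hY n hmn hnL ω)
    have h2 := abs_le.1 (hZ n hmn hnL ω)
    have h3 := abs_le.1 (le_refl (D (L - m) L ω))
    refine abs_le.2 ⟨?_, ?_⟩ <;> simp only [W] <;> linarith [h1.1, h1.2, h2.1, h2.2, h3.1, h3.2]
  have hW0 : 0 ≤ W := fun ω => (abs_nonneg _).trans (hW m le_rfl hmL ω)
  have hWint : ∫ ω, W ω ∂μ ≤ 5 * η := by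
    have h1 : ∫ ω, W ω ∂μ = ∫ ω, Y ω ∂μ + ∫ ω, Z ω ∂μ + ∫ ω, D (L - m) L ω ∂μ := by
      have hYZ : Integrable (fun ω => Y ω + Z ω) μ := hYi.add hZi
      rw [integral_add hYZ (hDi _ _), integral_add hYi hZi]
    have h2 : ∫ ω, D (L - m) L ω ∂μ = ∫ ω, D 0 m ω ∂μ := by
      have := hDadd 0 m (L - m)
      rw [zero_add, Nat.add_sub_cancel' hmL] at this
      exact integral_eq_of_ae_eq_comp (h.measurePreserving.iterate (L - m)) (hDm 0 m) this
    have h3 : ∫ ω, D 0 m ω ∂μ ≤ η ^ 2 := by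
      refine integral_abs_le_of_integral_sq_le ((hci ⊥ 0 m).sub (hci 𝒯 0 m)) ?_ hη ?_
      · refine Integrable.of_bound (((hm1 0 m).sub (hm2 0 m)).pow_const 2).aestronglyMeasurable
          1 ?_
        filter_upwards [h.condPred_mem_Icc h𝒯 a 0 m, h.condPred_mem_Icc bot_le a 0 m] with ω h1 h2
        rw [Real.norm_of_nonneg (sq_nonneg _), sq_le_one_iff_abs_le_one]
        exact abs_sub_le_iff.2 ⟨by linarith [h1.1, h2.2], by linarith [h1.2, h2.1]⟩
      · refine le_of_eq_of_le (integral_congr_ae (ae_of_all _ fun ω => ?_)) hgap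
        exact sub_sq_comm _ _
    -- The integrals of `Y`, `Z` and `D (L - m) L` add up to at most `2 * η + 2 * η + η ^ 2`, and `η
    -- ≤ 1`.
    nlinarith
  refine le_trans ?_ ((measureReal_maximal_ergodic_le h.measurePreserving hWm hWi hW0 ε L).trans
    hWint)
  refine mul_le_mul_of_nonneg_left ?_ hε
  let S : Set Ω := {ω | ∃ N ∈ Finset.range (L + 1), ε * N < ∑ n ∈ Finset.Ico m N, D 0 n ω}
  have hS : MeasurableSet S := by
    have : S = ⋃ N ∈ Finset.range (L + 1), {ω | ε * N < ∑ n ∈ Finset.Ico m N, D 0 n ω} := by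
      ext ω; simp [S]
    rw [this]
    exact Finset.measurableSet_biUnion _ fun N _ => measurableSet_lt measurable_const
      (Finset.measurable_sum _ fun n _ => hDm 0 n)
  change μ.real S ≤ _
  have hpre : μ.real S = μ.real (T^[L] ⁻¹' S) := by
    rw [measureReal_def, measureReal_def,
      (h.measurePreserving.iterate L).measure_preimage hS.nullMeasurableSet]
  rw [hpre, measureReal_def, measureReal_def]
  refine ENNReal.toReal_mono (measure_ne_top _ _) (measure_mono_ae ?_)
  -- Both sides equal `D L (L + n)` almost surely. Passing through this common shift gives the
  -- change of target without inverting `T`.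
  have hshift : ∀ᵐ ω ∂μ, ∀ n ≤ L, D 0 n (T^[L] ω) = D (L - n) L (T^[n] ω) := by
    rw [ae_all_iff]
    intro n
    by_cases hn : n ≤ L
    · have h1 := hDadd 0 n L
      have h2 := hDadd (L - n) L n
      rw [Nat.sub_add_cancel hn, add_comm L n] at h2
      rw [zero_add] at h1
      filter_upwards [h1, h2] with ω h1 h2 _
      exact h1.symm.trans h2
    · exact ae_of_all _ fun ω h => absurd h hn
  filter_upwards [hshift] with ω hω hωS
  obtain ⟨N, hN, hlt⟩ := hωS
  refine ⟨N, hN, hlt.trans_le ?_⟩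
  have hN := Finset.mem_range.1 hN
  calc ∑ n ∈ Finset.Ico m N, D 0 n (T^[L] ω)
      ≤ ∑ n ∈ Finset.Ico m N, W (T^[n] ω) := by
        refine Finset.sum_le_sum fun n hn => ?_
        have hn := Finset.mem_Ico.1 hn
        rw [hω n (by omega)]
        exact hW n hn.1 (by omega) _
    _ ≤ ∑ n ∈ Finset.range N, W (T^[n] ω) := by
        refine Finset.sum_le_sum_of_subset_of_nonneg (fun n hn => ?_) fun n _ _ => hW0 _
        exact Finset.mem_range.2 (Finset.mem_Ico.1 hn).2

/-- One `m` with a small gap and small oscillation suffices, so a frequently small gap is enough.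
The bound on the exceptional set is independent of `L`; let `L → ∞`, then `η → 0`. The first `m`
terms cost at most `m ≤ ε * N` for large `N`, hence the factor `2`. -/
theorem ae_eventually_sum_le [Fintype A] (h : IsStationaryProcess T μ ξ)
    (h𝒯 : ∀ k, 𝒯 ≤ future ξ k) (hinv : 𝒯.comap T = 𝒯) (a : A) {ε : ℝ} (hε : 0 < ε) :
    ∀ᵐ ω ∂μ, ∀ᶠ N : ℕ in atTop, ∑ n ∈ Finset.range N,
      |condPred μ ξ ⊥ a 0 n ω - condPred μ ξ 𝒯 a 0 n ω| ≤ 2 * ε * N := by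
  have h𝒯' := (h𝒯 0).trans (h.future_le 0)
  have hbinv : (⊥ : MeasurableSpace Ω).comap T = ⊥ := MeasurableSpace.comap_bot
  have hbound : ∀ᵐ ω ∂μ, ∀ n, |condPred μ ξ ⊥ a 0 n ω - condPred μ ξ 𝒯 a 0 n ω| ≤ 1 := by
    rw [ae_all_iff]
    intro n
    filter_upwards [h.condPred_mem_Icc h𝒯' a 0 n, h.condPred_mem_Icc bot_le a 0 n] with ω h1 h2
    exact abs_sub_le_iff.2 ⟨by linarith [h1.1, h2.2], by linarith [h1.2, h2.1]⟩
  let U : Set Ω := {ω | ¬∀ᶠ N : ℕ in atTop, ∑ n ∈ Finset.range N,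
      |condPred μ ξ ⊥ a 0 n ω - condPred μ ξ 𝒯 a 0 n ω| ≤ 2 * ε * N}
  have hU : ∀ η : ℝ, 0 < η → η ≤ 1 → μ U ≤ ENNReal.ofReal (5 * η / ε) := by
    intro η hη hη1
    have hη4 : 0 < η ^ 4 := by positivity
    obtain ⟨m, hgap, hm1, hm2⟩ := ((h.frequently_integral_sq_lt h𝒯 a hη4).and_eventually
      ((h.eventually_integral_sq_condPred_sub_le h𝒯' hinv a hη4).and
        (h.eventually_integral_sq_condPred_sub_le bot_le hbinv a hη4))).exists
    let S : ℕ → Set Ω := fun L => {ω | ∃ N ∈ Finset.range (L + 1), ε * N < ∑ n ∈ Finset.Ico m N,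
      |condPred μ ξ ⊥ a 0 n ω - condPred μ ξ 𝒯 a 0 n ω|}
    have hSmono : Monotone S := by
      rintro L L' hL ω ⟨N, hN, hlt⟩
      exact ⟨N, Finset.mem_range.2 ((Finset.mem_range.1 hN).trans_le (by omega)), hlt⟩
    have hS : ∀ L, m ≤ L → μ (S L) ≤ ENNReal.ofReal (5 * η / ε) := by
      intro L hL
      have := h.measureReal_exists_lt_sum_le h𝒯' hinv a hL hη hη1 (hm1 L hL) (hm2 L hL) hgap.le
        ε hε.le
      rw [← ofReal_measureReal (measure_ne_top μ (S L))]
      refine ENNReal.ofReal_le_ofReal ?_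
      rw [le_div_iff₀ hε, mul_comm]
      exact this
    have hSU : μ (⋃ L, S L) ≤ ENNReal.ofReal (5 * η / ε) :=
      le_of_tendsto (tendsto_measure_iUnion_atTop hSmono)
        (eventually_atTop.2 ⟨m, hS⟩)
    refine le_trans (measure_mono_ae ?_) hSU
    filter_upwards [hbound] with ω hω hωU
    have hfr : ∃ᶠ N : ℕ in atTop, ¬(∑ n ∈ Finset.range N,
      |condPred μ ξ ⊥ a 0 n ω - condPred μ ξ 𝒯 a 0 n ω| ≤ 2 * ε * N) := not_eventually.1 hωU
    obtain ⟨N₀, hN₀⟩ := exists_nat_gt ((m : ℝ) / ε)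
    obtain ⟨N, hN, hNN⟩ := (hfr.and_eventually (eventually_ge_atTop (max m N₀))).exists
    refine Set.mem_iUnion.2 ⟨N, N, Finset.self_mem_range_succ N, ?_⟩
    have hmN : m ≤ N := (le_max_left _ _).trans hNN
    have hmε : (m : ℝ) ≤ ε * N := by
      rw [div_lt_iff₀ hε] at hN₀
      have : (N₀ : ℝ) ≤ N := by exact_mod_cast (le_max_right _ _).trans hNN
      nlinarith
    rw [← Finset.sum_range_add_sum_Ico _ hmN] at hN
    have hfirst : ∑ n ∈ Finset.range m,
        |condPred μ ξ ⊥ a 0 n ω - condPred μ ξ 𝒯 a 0 n ω| ≤ m := by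
      refine (Finset.sum_le_sum fun n _ => hω n).trans ?_
      simp
    linarith [not_le.1 hN]
  have h0 : μ U = 0 := by
    refine le_antisymm (ENNReal.le_of_forall_pos_le_add fun δ hδ _ => ?_) zero_le
    rw [zero_add]
    have hδ' : (0 : ℝ) < δ := hδ
    refine (hU (min 1 (δ * ε / 5)) (lt_min one_pos (by positivity)) (min_le_left _ _)).trans ?_
    rw [← ENNReal.ofReal_coe_nnreal]
    refine ENNReal.ofReal_le_ofReal ?_
    rw [div_le_iff₀ hε]
    linarith [min_le_right 1 (δ * ε / 5)]
  exact h0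

theorem ae_tendsto_cesaro [Fintype A] (h : IsStationaryProcess T μ ξ)
    (h𝒯 : ∀ k, 𝒯 ≤ future ξ k) (hinv : 𝒯.comap T = 𝒯) (a : A) :
    ∀ᵐ ω ∂μ, Tendsto (fun N : ℕ => (1 / (N : ℝ)) * ∑ n ∈ Finset.range N,
      |condPred μ ξ ⊥ a 0 n ω - condPred μ ξ 𝒯 a 0 n ω|) atTop (𝓝 0) := by
  have h1 := ae_all_iff.2 fun k : ℕ => h.ae_eventually_sum_le h𝒯 hinv a
    (ε := 1 / ((k : ℝ) + 1)) (by positivity)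
  filter_upwards [h1] with ω hω
  have h0 : ∀ N : ℕ, 0 ≤ (1 / (N : ℝ)) * ∑ n ∈ Finset.range N,
      |condPred μ ξ ⊥ a 0 n ω - condPred μ ξ 𝒯 a 0 n ω| := fun N =>
    mul_nonneg (by positivity) (Finset.sum_nonneg fun _ _ => abs_nonneg _)
  rw [Metric.tendsto_atTop]
  intro ε hε
  obtain ⟨k, hk⟩ := exists_nat_one_div_lt (half_pos hε)
  obtain ⟨N₀, hN₀⟩ := eventually_atTop.1 ((hω k).and (eventually_gt_atTop 0))
  refine ⟨N₀, fun N hN => ?_⟩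
  rw [Real.dist_eq, sub_zero, abs_of_nonneg (h0 N)]
  obtain ⟨h2, h3⟩ := hN₀ N hN
  have h3 : (0 : ℝ) < N := by exact_mod_cast h3
  rw [one_div, inv_mul_lt_iff₀ h3]
  nlinarith

end IsStationaryProcess

end Maker

/-! ### Components of an induced decomposition as conditional laws. -/

section Induced

variable {Ω Θ : Type*} {D mΩ : MeasurableSpace Ω} [MeasurableSpace Θ] {μ : Measure Ω}
  {lam : Measure Θ} {κ : Kernel Θ Ω} {α : Ω → Θ}

theorem IsMeasurableQuotient.exists_measurable_ae_eq (hq : IsMeasurableQuotient D μ lam α)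
    {f : Θ → ENNReal} (hf : Measurable f) :
    ∃ g : Ω → ENNReal, Measurable[D] g ∧ f ∘ α =ᵐ[μ] g := by
  refine Measurable.ennreal_induction
    (motive := fun f => ∃ g : Ω → ENNReal, Measurable[D] g ∧ f ∘ α =ᵐ[μ] g)
    (fun c s hs => ?_) (fun f g _ _ _ ihf ihg => ?_) (fun f _ _ ih => ?_) hf
  · obtain ⟨S, hS, hSs⟩ := hq.preimage_mem s hs
    refine ⟨S.indicator fun _ => c, measurable_const.indicator hS, ?_⟩
    exact indicator_ae_eq_of_ae_eq_set hSs
  · obtain ⟨f', hf', hff⟩ := ihf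
    obtain ⟨g', hg', hgg⟩ := ihg
    exact ⟨f' + g', hf'.add hg', hff.add hgg⟩
  · choose g hg hfg using ih
    refine ⟨fun ω => ⨆ n, g n ω, Measurable.iSup hg, ?_⟩
    filter_upwards [ae_all_iff.2 hfg] with ω hω
    simp only [Function.comp_apply] at hω ⊢
    exact iSup_congr hω

theorem IsDecomposition.ae_ae [StandardBorelSpace Θ] (hd : IsDecomposition μ lam κ)
    {p : Ω → Prop} (hp : ∀ᵐ ω ∂μ, p ω) : ∀ᵐ θ ∂lam, ∀ᵐ ω ∂κ θ, p ω := by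
  have hbind : μ = lam.bind κ := by
    ext S hS
    rw [Measure.bind_apply hS κ.measurable.aemeasurable, hd.apply_eq S hS]
  rw [hbind] at hp
  exact Measure.ae_ae_of_ae_bind κ.measurable.aemeasurable hp

/-- The components of an induced decomposition are the conditional distributions given the
inducing σ-algebra. -/
theorem IsDecomposition.ae_eq_condExp [StandardBorelSpace Θ] [IsProbabilityMeasure μ]
    (hd : IsDecomposition μ lam κ) (hD : D ≤ mΩ) (hq : IsMeasurableQuotient D μ lam α)
    (hfib : ∀ᵐ θ ∂lam, κ θ (α ⁻¹' {θ}) = 1) {S : Set Ω} (hS : MeasurableSet[mΩ] S) :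
    (fun ω => (κ (α ω)).real S) =ᵐ[μ] μ⟦S | D⟧ := by
  have := hd.isProbabilityMeasure
  have := hd.isMarkovKernel
  have hα := hq.measurePreserving.measurable
  have hκS : Measurable fun θ => κ θ S := κ.measurable_coe hS
  have hint : Integrable (fun ω => (κ (α ω)).real S) μ :=
    Integrable.of_bound (hκS.ennreal_toReal.comp hα).aestronglyMeasurable 1
      (ae_of_all _ fun ω => by
        rw [Real.norm_of_nonneg measureReal_nonneg]; exact measureReal_le_one)
  refine ae_eq_condExp_of_forall_setIntegral_eq hD (integrable_indicator_one hS)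
    (fun s _ _ => hint.integrableOn) (fun s hs _ => ?_) ?_
  · obtain ⟨B, hB, hsB⟩ := hq.exists_preimage s hs
    have h1 : ∫ ω in α ⁻¹' B, (κ (α ω)).real S ∂μ = ∫ θ in B, (κ θ).real S ∂lam := by
      rw [← hq.measurePreserving.map_eq, setIntegral_map hB ?_ hα.aemeasurable]
      exact hκS.ennreal_toReal.aestronglyMeasurable
    -- By concentration on fibres, `κ θ (α ⁻¹' B ∩ S)` is `κ θ S` for `θ ∈ B` and zero otherwise.
    have h2 : ∫⁻ θ in B, κ θ S ∂lam = μ (α ⁻¹' B ∩ S) := by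
      rw [hd.apply_eq _ ((hα hB).inter hS), ← lintegral_indicator hB]
      refine lintegral_congr_ae ?_
      filter_upwards [hfib] with θ hθ
      have hae : ∀ᵐ ω ∂κ θ, α ω = θ :=
        (prob_compl_eq_zero_iff (hα (measurableSet_singleton θ))).2 hθ
      by_cases hB' : θ ∈ B
      · rw [Set.indicator_of_mem hB']
        refine measure_congr ?_
        filter_upwards [hae] with ω hω
        exact propext ⟨fun h => ⟨by rwa [← hω] at hB', h⟩, fun h => h.2⟩
      · rw [Set.indicator_of_notMem hB', eq_comm, measure_eq_zero_iff_ae_notMem]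
        filter_upwards [hae] with ω hω h
        exact hB' (hω ▸ h.1)
    rw [setIntegral_congr_set hsB, setIntegral_congr_set hsB, h1,
      setIntegral_indicator hS, setIntegral_const, smul_eq_mul, mul_one, measureReal_def, ← h2]
    exact integral_toReal hκS.aemeasurable (ae_of_all _ fun θ => measure_lt_top _ _)
  · obtain ⟨g, hg, hgg⟩ := hq.exists_measurable_ae_eq hκS
    refine ⟨fun ω => (g ω).toReal, hg.ennreal_toReal.stronglyMeasurable, ?_⟩
    filter_upwards [hgg] with ω h
    rw [← h]; rfl

end Induced

/-! ### Predictive distributions as conditional probabilities. -/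

section Predictive

variable {I A : Type*} [AddMonoidWithOne I]

/-- The outcome of period `n`. -/
def coord (I A : Type*) [AddMonoidWithOne I] (n : ℕ) (ω : I → A) : A := ω (n : I)

theorem history_eq_iInter (n : ℕ) (ω : I → A) :
    history n ω = ⋂ k ∈ Finset.range n, coord I A k ⁻¹' {ω (k : I)} := by
  ext x
  simp [history, coord]

theorem mem_history_self (n : ℕ) (ω : I → A) : ω ∈ history n ω := fun _ _ => rfl

theorem finite_range_history [Finite A] (n : ℕ) :
    (Set.range (history (I := I) (A := A) n)).Finite := by
  refine (Set.finite_range fun c : Fin n → A =>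
    {x : I → A | ∀ k : Fin n, x ((k : ℕ) : I) = c k}).subset ?_
  rintro _ ⟨ω, rfl⟩
  refine ⟨fun k => ω ((k : ℕ) : I), ?_⟩
  ext x
  exact ⟨fun h k hk => h ⟨k, hk⟩, fun h k => h k k.2⟩

variable [MeasurableSpace A]

theorem measurable_coord (n : ℕ) : Measurable (coord I A n) := measurable_pi_apply _

theorem block_coord_le (i j : ℕ) :
    block (coord I A) i j ≤ (inferInstance : MeasurableSpace (I → A)) :=
  iSup₂_le fun k _ => (measurable_coord k).comap_le

/-- On a history event all past outcomes are constant, so the past contributes nothing to the trace.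
-/
theorem block_comap_history_le {𝒯 : MeasurableSpace (I → A)} (n : ℕ) (ω : I → A) :
    (block (coord I A) 0 n ⊔ 𝒯).comap (Subtype.val : history n ω → I → A) ≤
      𝒯.comap Subtype.val := by
  rw [MeasurableSpace.comap_sup]
  refine sup_le ?_ le_rfl
  simp only [block, MeasurableSpace.comap_iSup, MeasurableSpace.comap_comp]
  refine iSup₂_le fun k hk => ?_
  have : coord I A k ∘ (Subtype.val : history n ω → I → A) = fun _ => ω (k : I) :=
    funext fun x => x.2 k hk.2
  rw [this, MeasurableSpace.comap_const]
  exact bot_le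

theorem ae_history_ne_zero [Finite A] (μ : Measure (I → A)) :
    ∀ᵐ ω ∂μ, ∀ n : ℕ, μ (history n ω) ≠ 0 := by
  rw [ae_all_iff]
  intro n
  have hfin := finite_range_history (I := I) (A := A) n
  have h1 : ∀ E ∈ Set.range (history (I := I) (A := A) n), ∀ᵐ ω ∂μ, ω ∈ E → μ E ≠ 0 := by
    intro E _
    by_cases hE : μ E = 0
    · filter_upwards [measure_eq_zero_iff_ae_notMem.1 hE] with ω h h' using absurd h' h
    · exact ae_of_all _ fun _ _ => hE
  filter_upwards [(ae_ball_iff hfin.countable).2 h1] with ω h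
  exact h _ ⟨ω, rfl⟩ (mem_history_self n ω)

variable [Fintype A] [DiscreteMeasurableSpace A]

theorem measurableSet_history (n : ℕ) (ω : I → A) :
    MeasurableSet[block (coord I A) 0 n] (history n ω) := by
  rw [history_eq_iInter]
  refine Finset.measurableSet_biInter _ fun k hk => ?_
  exact comap_le_block (Nat.zero_le k) (Finset.mem_range.1 hk) _
    ⟨_, measurableSet_singleton _, rfl⟩

/-- If `κ'` is the conditional distribution given `𝒯`, then the predictions of `κ'` are the
conditional probabilities given the history and `𝒯`. -/
theorem condPred_ae_eq_predictive {𝒯 : MeasurableSpace (I → A)}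
    {μ : @Measure (I → A) MeasurableSpace.pi} [IsProbabilityMeasure μ] (h𝒯 : 𝒯 ≤ MeasurableSpace.pi) 
    (κ' : (I → A) → @Measure (I → A) MeasurableSpace.pi)
    (hκ : ∀ S, MeasurableSet[MeasurableSpace.pi] S → (fun ω => (κ' ω).real S) =ᵐ[μ] μ⟦S | 𝒯⟧) (a : A) (n : ℕ) :
    ∀ᵐ ω ∂μ, condPred μ (coord I A) 𝒯 a 0 n ω = predictive (κ' ω) n ω a := by
  have hfin := finite_range_history (I := I) (A := A) n
  have hB : MeasurableSet[MeasurableSpace.pi] (coord I A n ⁻¹' {a}) :=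
    measurable_coord n (measurableSet_singleton a)
  -- There are finitely many histories, so each can be treated separately; on one of them,
  -- conditioning on the past and `𝒯` is elementary conditioning of `κ' ω`.
  have h1 : ∀ E ∈ Set.range (history (I := I) (A := A) n), ∀ᵐ ω ∂μ, ω ∈ E →
      condPred μ (coord I A) 𝒯 a 0 n ω = ((κ' ω)[|E]).real (coord I A n ⁻¹' {a}) := by
    rintro _ ⟨ω₀, rfl⟩
    have hE := measurableSet_history n ω₀
    have hE' := block_coord_le 0 n _ hE
    filter_upwards [condExp_eq_div_of_comap_le (μ := μ) (m := 𝒯)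
      (m' := block (coord I A) 0 n ⊔ 𝒯) le_sup_right (sup_le (block_coord_le 0 n) h𝒯)
      (le_sup_left (a := block (coord I A) 0 n) (b := 𝒯) _ hE) hB
      (block_comap_history_le n ω₀), hκ _ hE', hκ _ (hB.inter hE')] with ω h2 h3 h4 hω
    rw [condPred, h2 hω, ← h3, ← h4, measureReal_def (_[|_]), cond_apply hE', Set.inter_comm,
      ENNReal.toReal_mul, ENNReal.toReal_inv, div_eq_inv_mul]
    rfl
  filter_upwards [(ae_ball_iff hfin.countable).2 h1] with ω h
  exact h _ ⟨ω, rfl⟩ (mem_history_self n ω)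

end Predictive

/-! ### Invariance of the tail and conclusion. -/

section Main

variable {I A : Type*} [AddMonoidWithOne I]

/-- A tail event is, for every `m`, the preimage of an event of `future ξ m`. Surjectivity makes
preimages injective, so these events coincide and lie in the tail. -/
theorem IsStationaryProcess.comap_iInf_future {Ω A : Type*} [MeasurableSpace A]
    {mΩ : MeasurableSpace Ω} {T : Ω → Ω} {μ : Measure Ω} {ξ : ℕ → Ω → A}
    (h : IsStationaryProcess T μ ξ) (hT : Function.Surjective T) :
    (⨅ m, future ξ m).comap T = ⨅ m, future ξ m := by
  have hsucc : ∀ m, (future ξ m).comap T = future ξ (m + 1) := fun m => h.comap_future m 1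
  apply le_antisymm
  · refine le_iInf fun m => (MeasurableSpace.comap_mono (iInf_le _ m)).trans ?_
    rw [hsucc]
    exact iSup₂_le fun k hk => comap_le_future ((Nat.le_succ m).trans hk)
  · intro S hS
    rw [MeasurableSpace.measurableSet_iInf] at hS
    have h1 : ∀ m, ∃ S', MeasurableSet[future ξ m] S' ∧ T ⁻¹' S' = S := fun m => by
      have := hS (m + 1)
      rwa [← hsucc] at this
    choose S' hS' hS'' using h1
    refine ⟨S' 0, MeasurableSpace.measurableSet_iInf.2 fun m => ?_, hS'' 0⟩
    rw [hT.preimage_injective ((hS'' 0).trans (hS'' m).symm)]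
    exact hS' m

theorem surjective_shift_nat : Function.Surjective (shift : (ℕ → A) → ℕ → A) := fun ω =>
  -- Subtraction is truncated at `0`; the value there is immaterial because the shift forgets it.
  ⟨fun i => ω (i - 1), by ext i; simp [shift]⟩

theorem surjective_shift_int : Function.Surjective (shift : (ℤ → A) → ℤ → A) := fun ω =>
  ⟨fun i => ω (i - 1), by ext i; simp [shift]⟩

variable [MeasurableSpace A]

theorem futureTail_le_future (k : ℕ) : futureTail I A ≤ future (coord I A) k :=
  iInf_le _ k

theorem futureTail_le : futureTail I A ≤ MeasurableSpace.pi :=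
  (futureTail_le_future 0).trans (iSup₂_le fun k _ => (measurable_coord k).comap_le)

theorem isStationaryProcess_coord {μ : Measure (I → A)} (hμ : IsStationary μ) :
    IsStationaryProcess shift μ (coord I A) where
  measurePreserving := hμ
  measurable := measurable_coord
  comp_eq n := by
    ext ω
    simp [coord, shift]

variable [Fintype A] [DiscreteMeasurableSpace A]

theorem isWeaklyLearnable_of_isInducedDecomposition
    (hsurj : Function.Surjective (shift : (I → A) → I → A)) {μ : Measure (I → A)}
    [IsProbabilityMeasure μ] (hμ : IsStationary μ) {Θ : Type*} [MeasurableSpace Θ]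
    [StandardBorelSpace Θ] {lam : Measure Θ} {κ : Kernel Θ (I → A)}
    (hind : IsInducedDecomposition (futureTail I A) μ lam κ) : IsWeaklyLearnable μ lam κ := by
  obtain ⟨hd, α, hq, hfib⟩ := hind
  have := hd.isMarkovKernel
  have hproc := isStationaryProcess_coord hμ
  have h𝒯 : futureTail I A ≤ MeasurableSpace.pi := futureTail_le
  have h1 : ∀ᵐ ω ∂μ, ∀ a n, condPred μ (coord I A) (futureTail I A) a 0 n ω =
      predictive (κ (α ω)) n ω a := by
    simp only [ae_all_iff]
    exact fun a n => condPred_ae_eq_predictive h𝒯 _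
      (fun S hS => hd.ae_eq_condExp h𝒯 hq hfib hS) a n
  -- The belief `μ` itself is the constant conditional law given the trivial σ-algebra.
  have h2 : ∀ᵐ ω ∂μ, ∀ a n, condPred μ (coord I A) ⊥ a 0 n ω = predictive μ n ω a := by
    simp only [ae_all_iff]
    refine fun a n => condPred_ae_eq_predictive bot_le (fun _ => μ) (fun S hS => ?_) a n
    rw [condExp_bot, integral_indicator_const _ hS]
    simp
  have h3 := ae_all_iff.2 fun a => hproc.ae_tendsto_cesaro futureTail_le_future
    (hproc.comap_iInf_future hsurj) a
  have h4 : ∀ᵐ ω ∂μ, (∀ n : ℕ, μ (history n ω) ≠ 0) ∧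
      StronglyCesaroTendsto (fun n => ‖predictive μ n ω - predictive (κ (α ω)) n ω‖) 0 := by
    filter_upwards [h1, h2, h3, ae_history_ne_zero μ] with ω h1 h2 h3 h4
    refine ⟨h4, ?_⟩
    have hsum := tendsto_finsetSum Finset.univ fun a (_ : a ∈ Finset.univ) => h3 a
    rw [Finset.sum_const_zero] at hsum
    refine squeeze_zero (fun N => mul_nonneg (by positivity)
      (Finset.sum_nonneg fun _ _ => abs_nonneg _)) (fun N => ?_) hsum
    -- The maximum norm is at most the sum over outcomes, so coordinatewise convergence suffices.
    rw [← Finset.mul_sum, Finset.sum_comm]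
    refine mul_le_mul_of_nonneg_left (Finset.sum_le_sum fun n _ => ?_) (by positivity)
    rw [sub_zero, abs_norm]
    refine (pi_norm_le_iff_of_nonneg (Finset.sum_nonneg fun _ _ => abs_nonneg _)).2 fun a => ?_
    rw [Pi.sub_apply, Real.norm_eq_abs, ← h1 a n, ← h2 a n]
    exact Finset.single_le_sum (f := fun a => |condPred μ (coord I A) ⊥ a 0 n ω -
      condPred μ (coord I A) (futureTail I A) a 0 n ω|) (fun _ _ => abs_nonneg _)
      (Finset.mem_univ a)
  -- A `μ`-almost sure statement holds `κ θ`-almost surely for almost every `θ`, and there `α ω` may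
  -- be replaced by `θ`.
  filter_upwards [hd.ae_ae h4, hfib] with θ h5 h6
  have h7 := (prob_compl_eq_zero_iff
    (hq.measurePreserving.measurable (measurableSet_singleton θ))).2 h6
  have h8 : ∀ᵐ ω ∂κ θ, α ω = θ := h7
  filter_upwards [h5, h8] with ω h9 h10
  rwa [h10] at h9

end Main

end WeakLearning

theorem mainTheorem4 {A : Type*} [Fintype A] [MeasurableSpace A] [DiscreteMeasurableSpace A] :
    (∀ μ : Measure (ℕ → A), IsProbabilityMeasure μ → WeakLearning.IsStationary μ →
      (∃ (Θ : Type) (_ : MeasurableSpace Θ) (_ : StandardBorelSpace Θ)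
        (lam : Measure Θ) (κ : Kernel Θ (ℕ → A)),
        WeakLearning.IsInducedDecomposition (WeakLearning.futureTail ℕ A) μ lam κ) ∧
      ∀ (Θ : Type*) [MeasurableSpace Θ] [StandardBorelSpace Θ]
        (lam : Measure Θ) (κ : Kernel Θ (ℕ → A)),
        WeakLearning.IsInducedDecomposition (WeakLearning.futureTail ℕ A) μ lam κ →
          WeakLearning.IsWeaklyLearnable μ lam κ) ∧
    (∀ μ : Measure (ℤ → A), IsProbabilityMeasure μ → WeakLearning.IsStationary μ →
      (∃ (Θ : Type) (_ : MeasurableSpace Θ) (_ : StandardBorelSpace Θ)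
        (lam : Measure Θ) (κ : Kernel Θ (ℤ → A)),
        WeakLearning.IsInducedDecomposition (WeakLearning.futureTail ℤ A) μ lam κ) ∧
      ∀ (Θ : Type*) [MeasurableSpace Θ] [StandardBorelSpace Θ]
        (lam : Measure Θ) (κ : Kernel Θ (ℤ → A)),
        WeakLearning.IsInducedDecomposition (WeakLearning.futureTail ℤ A) μ lam κ →
          WeakLearning.IsWeaklyLearnable μ lam κ) := by
  refine ⟨fun μ _ hμ => ⟨?_, fun Θ _ _ lam κ h => ?_⟩, fun μ _ hμ => ⟨?_, fun Θ _ _ lam κ h => ?_⟩⟩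
  · exact WeakLearning.exists_isInducedDecomposition μ WeakLearning.futureTail_le
  · exact WeakLearning.isWeaklyLearnable_of_isInducedDecomposition
      WeakLearning.surjective_shift_nat hμ h
  · exact WeakLearning.exists_isInducedDecomposition μ WeakLearning.futureTail_le
  · exact WeakLearning.isWeaklyLearnable_of_isInducedDecomposition
      WeakLearning.surjective_shift_int hμ h
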